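/- **A lower bound theorem for $\mathcal W_k(d)$.** All simplicial complexes are finite and abstract. *Definitions.* For a finite set $\alpha$, $\overline\alpha$ (resp. $\partial\alpha$) is the complex of all (resp. all proper) subsets of $\alpha$, and $X*Y$ denotes the join. The standard sphere $S^{e}_{e+2}$ is $\partial\alpha$ with $\#\alpha=e+2$. If $X$ is an $e$-dimensional complex and $\alpha,\beta$ are disjoint non-empty finite sets with $\dim\alpha+\dim\beta=e$ such that the subcomplex of $X$ induced on $\alpha\sqcup\beta$ is $\overline\alpha*\partial\beta$, then $Y=(X\setminus(\overline\alpha*\partial\beta))\cup(\partial\alpha*\overline\beta)$ is said to be obtained from $X$ by a bistellar move of index $\dim\beta$. (A move of index $0$ introduces a new vertex.) An $e$-dimensional complex is a $k$-stellated sphere if, up to isomorphism, it is obtained from $S^{e}_{e+2}$ by a finite sequence of bistellar moves, each of index $<k$. For $0\le k\le d$, $\mathcal W_k(d)$ is the class of connected $d$-dimensional simplicial complexes all of whose vertex links are $k$-stellated $(d-1)$-spheres. A complex is 2-neighbourly if any two of its vertices form an edge. For a complex $M$ of dimension $d$ with $f_i$ faces of dimension $i$ ($f_{-1}=1$), put $$h_j=\sum_{i=-1}^{j-1}(-1)^{j-i-1}\binom{d-i}{j-i-1}f_i\quad(0\le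 j\le d+1),\qquad h_{-1}=0,\qquad g_j=h_j-h_{j-1}\quad(0\le j\le d+1).$$ For a field $\mathbb F$, $\beta_i=\dim_{\mathbb F}H_i(M;\mathbb F)$ denotes the (unreduced) $i$-th Betti number of $M$. *Statement.* Let $0\le k\le d$, let $M\in\mathcal W_k(d)$ be 2-neighbourly, and let $\mathbb F$ be any field. Then: (a) if $d=2k$, then $g_{l+1}\ge\binom{d+2}{l+1}\sum_{i=1}^{l}(-1)^{l-i}\beta_i$ for $1\le l\le k-1$; (b) if $d\ge 2k+1$, then $g_{l+1}\ge\binom{d+2}{l+1}\sum_{i=1}^{l}(-1)^{l-i}\beta_i$ for $1\le l\le k$; (c) if $d\ge 2k+2$, then $g_{l+1}=\binom{d+2}{l+1}\sum_{i=1}^{l}(-1)^{l-i}\beta_i$ for $k\le l\le d-k-1$; (d) if $d\ge 2k+2$, then $\beta_i=0$ for $k+1\le i\le d-k-1$. -/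

import Mathlib

namespace PreAbstractSimplicialComplex

/- Conventions.  Faces of a complex are nonempty finite sets, as in Mathlib; the empty face, which
combinatorialists count as a face of every complex, is put back by hand where it matters (in joins
and in the `f`-vector).  The vertices of a complex `X` are the `v` with `{v} ∈ X`; the ambient type
may contain further points.  A face with `i + 1` vertices has dimension `i`. -/

section Combinatorics

variable {V : Type*}

/-- The simplicial complex of all (nonempty) subsets of the finite set `α`. -/
def simplex (α : Finset V) : PreAbstractSimplicialComplex V where
  faces := {σ | σ.Nonempty ∧ σ ⊆ α}
  isRelLowerSet_faces := fun {_} h => ⟨h.1, fun _ hts ht => ⟨ht, hts.trans h.2⟩⟩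

/-- The boundary complex of the simplex on `α`: all (nonempty) proper subsets of `α`.  If `α` has
`n + 1` elements this is the standard sphere of dimension `n - 1`. -/
def simplexBoundary (α : Finset V) : PreAbstractSimplicialComplex V where
  faces := {σ | σ.Nonempty ∧ σ ⊂ α}
  isRelLowerSet_faces := fun {_} h => ⟨h.1, fun _ hts ht => ⟨ht, lt_of_le_of_lt hts h.2⟩⟩

/-- The subcomplex of `X` induced on the vertices in `A`. -/
def induced (X : PreAbstractSimplicialComplex V) (A : Set V) : PreAbstractSimplicialComplex V where
  faces := {σ | σ ∈ X ∧ (σ : Set V) ⊆ A}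
  isRelLowerSet_faces := fun {_} h => ⟨(X.isRelLowerSet_faces h.1).1, fun _ hts ht =>
    ⟨(X.isRelLowerSet_faces h.1).2 hts ht, (Finset.coe_subset.2 hts).trans h.2⟩⟩

/-- The join of two complexes: its faces are the disjoint unions of a face of `X` and a face
of `Y`, where each of the two may be the empty face (but not both). -/
def join [DecidableEq V] (X Y : PreAbstractSimplicialComplex V) :
    PreAbstractSimplicialComplex V where
  faces := {σ | σ.Nonempty ∧ ∃ a b : Finset V, (a = ∅ ∨ a ∈ X) ∧ (b = ∅ ∨ b ∈ Y) ∧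
    Disjoint a b ∧ σ = a ∪ b}
  isRelLowerSet_faces := by
    rintro σ ⟨hσ, a, b, ha, hb, hab, rfl⟩
    refine ⟨hσ, fun τ hτ hne => ⟨hne, a ∩ τ, b ∩ τ, ?_, ?_, ?_, ?_⟩⟩
    · rcases Finset.eq_empty_or_nonempty (a ∩ τ) with h | h
      · exact Or.inl h
      · rcases ha with rfl | ha
        · simp at h
        · exact Or.inr ((X.isRelLowerSet_faces ha).2 Finset.inter_subset_left h)
    · rcases Finset.eq_empty_or_nonempty (b ∩ τ) with h | h
      · exact Or.inl h
      · rcases hb with rfl | hb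
        · simp at h
        · exact Or.inr ((Y.isRelLowerSet_faces hb).2 Finset.inter_subset_left h)
    · exact Finset.disjoint_of_subset_left Finset.inter_subset_left
        (Finset.disjoint_of_subset_right Finset.inter_subset_left hab)
    · rw [← Finset.union_inter_distrib_right]
      exact (Finset.inter_eq_right.2 hτ).symm

/-- The link of the vertex `v`. -/
def link [DecidableEq V] (X : PreAbstractSimplicialComplex V) (v : V) :
    PreAbstractSimplicialComplex V where
  faces := {σ | σ.Nonempty ∧ v ∉ σ ∧ insert v σ ∈ X}
  isRelLowerSet_faces := fun {_} h => ⟨h.1, fun _ hts ht => ⟨ht, fun hv => h.2.1 (hts hv),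
    (X.isRelLowerSet_faces h.2.2).2 (Finset.insert_subset_insert _ hts)
      (Finset.insert_nonempty _ _)⟩⟩

/-- `X` has dimension `d`. -/
def HasDim (X : PreAbstractSimplicialComplex V) (d : ℕ) : Prop :=
  (∃ σ ∈ X, σ.card = d + 1) ∧ ∀ σ ∈ X, σ.card ≤ d + 1

/-- Any two vertices of `X` are joined by a path of edges of `X`. -/
def Connected [DecidableEq V] (X : PreAbstractSimplicialComplex V) : Prop :=
  (∃ v : V, {v} ∈ X) ∧ ∀ u v : V, {u} ∈ X → {v} ∈ X →
    Relation.ReflTransGen (fun a b : V => ({a, b} : Finset V) ∈ X) u v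

/-- `X` is `l`-neighbourly: any `l` vertices of `X` form a face. -/
def Neighbourly (X : PreAbstractSimplicialComplex V) (l : ℕ) : Prop :=
  ∀ σ : Finset V, σ.Nonempty → (∀ v ∈ σ, {v} ∈ X) → σ.card = l → σ ∈ X

/-- `Y` is obtained from the `(n - 1)`-dimensional complex `X` by a bistellar move `α ↦ β` of index
`dim β = β.card - 1` less than `k`: the induced subcomplex of `X` on `α ⊔ β` is the
`(n - 1)`-dimensional complex `simplex α * ∂β`, and it is replaced by `∂α * simplex β`. -/
def BistellarMove [DecidableEq V] (n k : ℕ) (X Y : PreAbstractSimplicialComplex V) : Prop :=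
  ∃ α β : Finset V, α.Nonempty ∧ β.Nonempty ∧ Disjoint α β ∧
    α.card + β.card = n + 1 ∧ β.card - 1 < k ∧
    X.induced ((α ∪ β : Finset V) : Set V) = join (simplex α) (simplexBoundary β) ∧
    Y.faces = (X.faces \ (join (simplex α) (simplexBoundary β)).faces) ∪
      (join (simplexBoundary α) (simplex β)).faces

/-- `X` is a `k`-stellated sphere of dimension `n - 1`: up to isomorphism, it is obtained from the
standard sphere of dimension `n - 1`, which has `n + 1` vertices, by finitely many bistellar moves
of index less than `k`.  The moves take place on a countably infinite supply of vertices, as they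
may create new ones; the dimension is written `n - 1` so that dimension `-1` is included. -/
def IsStellatedSphere (n k : ℕ) (X : PreAbstractSimplicialComplex V) : Prop :=
  ∃ f : V → ℕ, Set.InjOn f {v | {v} ∈ X} ∧
    Relation.ReflTransGen (BistellarMove n k) (simplexBoundary (Finset.range (n + 1))) (X.map f)

/-- The class `W_k(d)`, `0 ≤ k ≤ d`: the finite connected simplicial complexes of dimension `d` all
of whose vertex links are `k`-stellated spheres of dimension `d - 1`. -/
structure IsW [DecidableEq V] (k d : ℕ) (X : PreAbstractSimplicialComplex V) : Prop where
  le : k ≤ d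
  finite : X.faces.Finite
  hasDim : X.HasDim d
  connected : X.Connected
  link : ∀ v : V, {v} ∈ X → IsStellatedSphere d k (X.link v)

/-- The number `f_{s-1}` of faces with `s` elements; `f_{-1} = 1` counts the empty face. -/
noncomputable def faceCount (X : PreAbstractSimplicialComplex V) (s : ℕ) : ℕ :=
  if s = 0 then 1 else {σ : Finset V | σ ∈ X ∧ σ.card = s}.ncard

/-- The `h`-numbers of a complex `X` of dimension `d`, for `0 ≤ j ≤ d + 1`:
`h_j = ∑_{i=-1}^{j-1} (-1)^{j-i-1} C(d-i, j-i-1) f_i`, with `s = i + 1`. -/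
noncomputable def hNumber (X : PreAbstractSimplicialComplex V) (d j : ℕ) : ℤ :=
  ∑ s ∈ Finset.range (j + 1), (-1) ^ (j - s) * ((d + 1 - s).choose (j - s) : ℤ) * X.faceCount s

/-- The `g`-numbers of a complex `X` of dimension `d`, for `0 ≤ j ≤ d + 1`:
`g_j = h_j - h_{j-1}`, with `h_{-1} = 0`. -/
noncomputable def gNumber (X : PreAbstractSimplicialComplex V) (d : ℕ) : ℕ → ℤ
  | 0 => X.hNumber d 0
  | j + 1 => X.hNumber d (j + 1) - X.hNumber d j

end Combinatorics

section Homology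

/-- The dimension of the quotient space `Z / B`, for subspaces `B ≤ Z` of a vector space. -/
noncomputable def quotientDim {F C : Type*} [Field F] [AddCommGroup C] [Module F C]
    (Z B : Submodule F C) : ℕ :=
  Module.finrank F (Z ⧸ B.submoduleOf Z)

variable {V : Type*} [LinearOrder V] (F : Type*) [Field F]

/-- The simplicial boundary operator with coefficients in `F`: each simplex is oriented by the order
of `V`, and its facet opposite to `v` gets the sign `(-1)^{number of vertices before v}`. -/
noncomputable def boundaryMap (V : Type*) [LinearOrder V] (F : Type*) [Field F] :
    (Finset V →₀ F) →ₗ[F] (Finset V →₀ F) :=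
  Finsupp.linearCombination F fun σ : Finset V =>
    ∑ v ∈ σ, Finsupp.single (σ.erase v) ((-1 : F) ^ (σ.filter (· < v)).card)

/-- The space of `i`-dimensional simplicial chains of `X`. -/
noncomputable def chains (X : PreAbstractSimplicialComplex V) (i : ℕ) :
    Submodule F (Finset V →₀ F) :=
  Finsupp.supported F F {σ : Finset V | σ ∈ X ∧ σ.card = i + 1}

/-- The `i`-dimensional simplicial cycles; all `0`-chains are cycles (unreduced homology). -/
noncomputable def cycles (X : PreAbstractSimplicialComplex V) : ℕ → Submodule F (Finset V →₀ F)
  | 0 => X.chains F 0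
  | i + 1 => X.chains F (i + 1) ⊓ LinearMap.ker (boundaryMap V F)

/-- The `i`-dimensional simplicial boundaries. -/
noncomputable def boundaries (X : PreAbstractSimplicialComplex V) (i : ℕ) :
    Submodule F (Finset V →₀ F) :=
  (X.chains F (i + 1)).map (boundaryMap V F)

/-- The Betti number `β_i(X; F) = dim H_i(X; F)`, where `H_i(X; F)` is the space of cycles modulo
the space of boundaries. -/
noncomputable def betti (X : PreAbstractSimplicialComplex V) (i : ℕ) : ℕ :=
  quotientDim (X.cycles F i) (X.boundaries F i)

end Homology

end PreAbstractSimplicialComplex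

namespace PreAbstractSimplicialComplex

/-! ### Interval partitions of low skeleta of stellated spheres -/

section Shelling

variable {V : Type*}

/-! The argument bounds the rank of one simplicial boundary map from below, once for every ordering
of the vertices, and averages over all orderings.

A bistellar move `α ↦ β` of index `< k` on a `(d - 1)`-sphere only deletes faces containing `α`,
which has at least `d + 1 - k` elements. Faces with at most `c ≤ d - k` vertices therefore survive,
and each move adds exactly those in the interval `[β, α ∪ β]`. So such a skeleton of a vertex link
is partitioned by intervals with `|α| + |β| = d + 1` and `|β| ≤ k` (`IsSkeletonShelling`).

Restricted to a vertex set `A`, an interval that meets `A` is a Boolean lattice. If `α` meets `A`,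
the sets can be matched by toggling one vertex, giving a triangular block of the incidence matrix
whose size is the truncated alternating count. If `α` misses `A`, only `β` is left, an unmatched
term `(-1)^(l - |β|)`. Adding the vertices of `M` in some order and coning off the blocks of the
links gives, in `exists_isTriangular_of_links`, an independent family of boundaries whose size is
the alternating sum of face numbers minus the unmatched terms.

The interval at `v` is unmatched when `v` comes after `β` and before `α`, an event of probability `1
/ ((d + 2) * C(d + 1, |β|))` (`card_orderings_mul_choose`). The links together have `(j + 1) g_{j+1}
+ (d + 2 - j) g_j` intervals with `|β| = j` (`sum_card_eq_gNumber`). With these weights the average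
telescopes to `g_{l+1} / C(d + 2, l + 1) + (-1)^l`, and rank–nullity turns the rank bound into the
inequality on Betti numbers (`IsW.alternating_betti_le`).

For `k < j ≤ d - k` there are no intervals with `|β| = j`, so `g_{j+1} / C(d + 2, j + 1) + g_j / C(d
+ 2, j) = 0`. Adding the inequalities for `l` and `l + 1` then gives `β_{l+1} ≤ 0`, which forces
vanishing and equality in both. -/

theorem mem_simplexBoundary {α σ : Finset V} :
    σ ∈ simplexBoundary α ↔ σ.Nonempty ∧ σ ⊂ α := Iff.rfl

theorem mem_induced {X : PreAbstractSimplicialComplex V} {A : Set V} {σ : Finset V} :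
    σ ∈ X.induced A ↔ σ ∈ X ∧ (σ : Set V) ⊆ A := Iff.rfl

theorem mem_mono (X : PreAbstractSimplicialComplex V) {σ τ : Finset V} (h : σ ∈ X) (hτ : τ ⊆ σ)
    (hne : τ.Nonempty) : τ ∈ X := (X.isRelLowerSet_faces h).2 hτ hne

theorem nonempty_of_mem (X : PreAbstractSimplicialComplex V) {σ : Finset V} (h : σ ∈ X) :
    σ.Nonempty := (X.isRelLowerSet_faces h).1

variable [DecidableEq V]

theorem mem_link {X : PreAbstractSimplicialComplex V} {v : V} {σ : Finset V} :
    σ ∈ X.link v ↔ σ.Nonempty ∧ v ∉ σ ∧ insert v σ ∈ X := Iff.rfl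

theorem mem_join_simplex_boundary {α β σ : Finset V} (hd : Disjoint α β) :
    σ ∈ join (simplex α) (simplexBoundary β) ↔
      σ.Nonempty ∧ σ ⊆ α ∪ β ∧ (¬ β ⊆ σ ∨ β = ∅) := by
  constructor
  · rintro ⟨hne, a, b, ha, hb, hab, rfl⟩
    have ha' : a ⊆ α := by rcases ha with rfl | ha; exacts [Finset.empty_subset _, ha.2]
    have hb' : b ⊆ β := by rcases hb with rfl | hb; exacts [Finset.empty_subset _, hb.2.1]
    refine ⟨hne, Finset.union_subset_union ha' hb', ?_⟩
    by_cases h : β = ∅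
    · exact Or.inr h
    left
    intro hβ
    have : β ⊆ b := fun x hx => by
      rcases Finset.mem_union.1 (hβ hx) with h' | h'
      · exact absurd hx (Finset.disjoint_left.1 hd (ha' h'))
      · exact h'
    rcases hb with rfl | hb
    · exact h (Finset.subset_empty.1 this)
    · exact hb.2.2 this
  · rintro ⟨hne, hσ, h⟩
    refine ⟨hne, σ ∩ α, σ ∩ β, ?_, ?_, ?_, ?_⟩
    · rcases Finset.eq_empty_or_nonempty (σ ∩ α) with h | h
      · exact Or.inl h
      · exact Or.inr ⟨h, Finset.inter_subset_right⟩
    · rcases Finset.eq_empty_or_nonempty (σ ∩ β) with h' | h'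
      · exact Or.inl h'
      · refine Or.inr ⟨h', Finset.inter_subset_right, fun hb => ?_⟩
        rcases h with h | h
        · exact h (fun x hx => (Finset.mem_inter.1 (hb hx)).1)
        · subst h; simp at h'
    · exact Finset.disjoint_of_subset_left Finset.inter_subset_right
        (Finset.disjoint_of_subset_right Finset.inter_subset_right hd)
    · rw [← Finset.inter_union_distrib_left, Finset.inter_eq_left.2 hσ]

theorem mem_join_boundary_simplex {α β σ : Finset V} (hd : Disjoint α β) :
    σ ∈ join (simplexBoundary α) (simplex β) ↔
      σ.Nonempty ∧ σ ⊆ α ∪ β ∧ (¬ α ⊆ σ ∨ α = ∅) := by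
  have key : σ ∈ join (simplexBoundary α) (simplex β) ↔
      σ ∈ join (simplex β) (simplexBoundary α) := by
    constructor <;>
    · rintro ⟨hne, a, b, ha, hb, hab, rfl⟩
      exact ⟨hne, b, a, hb, ha, hab.symm, Finset.union_comm _ _⟩
  rw [key, mem_join_simplex_boundary hd.symm, Finset.union_comm]

/-- `L` describes the faces of `X` with at most `c` vertices: they are partitioned by the intervals
`[β, α ∪ β]`, for `(α, β)` in `L`, and in the order opposite to that of `L` every interval
adds new faces to a complex. -/
structure IsSkeletonShelling (X : PreAbstractSimplicialComplex V) (d k c : ℕ)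
    (L : List (Finset V × Finset V)) : Prop where
  disjoint : ∀ p ∈ L, Disjoint p.1 p.2
  card_add : ∀ p ∈ L, p.1.card + p.2.card = d + 1
  card_le : ∀ p ∈ L, p.2.card ≤ k
  vertex : ∀ p ∈ L, ∀ x ∈ p.1 ∪ p.2, {x} ∈ X
  pairwise : L.Pairwise fun p q =>
    ∀ σ : Finset V, σ.card ≤ c → q.2 ⊆ σ → σ ⊆ q.1 ∪ q.2 → ¬ p.2 ⊆ σ
  mem_iff : ∀ σ : Finset V, σ.card ≤ c →
    ((σ = ∅ ∨ σ ∈ X) ↔ ∃ p ∈ L, p.2 ⊆ σ ∧ σ ⊆ p.1 ∪ p.2)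

theorem isSkeletonShelling_simplexBoundary {d k c : ℕ} {α : Finset V} (hα : α.card = d + 1)
    (hd : 1 ≤ d) (hc : c ≤ d) : (simplexBoundary α).IsSkeletonShelling d k c [(α, ∅)] where
  disjoint := by simp
  card_add := by simp [hα]
  card_le := by simp
  vertex := by
    simp only [List.mem_singleton, forall_eq, Finset.union_empty]
    intro x hx
    refine ⟨Finset.singleton_nonempty x, Finset.singleton_subset_iff.2 hx, fun h => ?_⟩
    have := Finset.card_le_card h
    simp at this
    omega
  pairwise := List.pairwise_singleton _ _
  mem_iff := by
    intro σ hσ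
    simp only [List.mem_singleton, exists_eq_left, Finset.empty_subset, Finset.union_empty,
      true_and, mem_simplexBoundary]
    constructor
    · rintro (rfl | h)
      · simp
      · exact h.2.1
    · intro h
      rcases Finset.eq_empty_or_nonempty σ with h' | h'
      · exact Or.inl h'
      · refine Or.inr ⟨h', h, fun h'' => ?_⟩
        have := Finset.card_le_card h''
        omega

/-- Below the size of `α` a move deletes nothing, and the faces it adds are those between `β` and `α
∪ β`; the new interval is put at the head of the list. -/
theorem IsSkeletonShelling.bistellarMove {X Y : PreAbstractSimplicialComplex V} {d k c : ℕ}
    {L : List (Finset V × Finset V)} (hL : X.IsSkeletonShelling d k c L) (hc : 1 ≤ c)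
    (hck : c + k ≤ d) (h : BistellarMove d k X Y) :
    ∃ L', Y.IsSkeletonShelling d k c L' := by
  obtain ⟨α, β, hα, hβ, hd, hcard, hβk, hind, hY⟩ := h
  have hβ0 : β ≠ ∅ := hβ.ne_empty
  have hβ1 := hβ.card_pos
  have memY : ∀ σ, σ ∈ Y ↔ (σ ∈ X ∧ σ ∉ join (simplex α) (simplexBoundary β)) ∨
      σ ∈ join (simplexBoundary α) (simplex β) := fun σ => by
    change σ ∈ Y.faces ↔ _
    rw [hY]; rfl
  have memI : ∀ σ : Finset V, σ.Nonempty → σ ⊆ α ∪ β → (σ ∈ X ↔ ¬ β ⊆ σ) := fun σ h1 h2 => by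
    have := mem_join_simplex_boundary (σ := σ) hd
    rw [← hind, mem_induced, Finset.coe_subset] at this
    simpa [h1, h2, hβ0] using this
  -- Index `< k` means `|β| ≤ k`, hence `|α| ≥ d + 1 - k > c`.
  have small : ∀ σ : Finset V, σ.card ≤ c → ¬ α ⊆ σ := fun σ h1 h2 => by
    have := Finset.card_le_card h2
    omega
  have hXY : ∀ σ : Finset V, σ.card ≤ c → σ ∈ X → σ ∈ Y := fun σ h1 h2 => by
    rw [memY]
    by_cases h : σ ∈ join (simplex α) (simplexBoundary β)
    · right
      rw [mem_join_boundary_simplex hd]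
      rw [mem_join_simplex_boundary hd] at h
      exact ⟨h.1, h.2.1, Or.inl (small σ h1)⟩
    · exact Or.inl ⟨h2, h⟩
  refine ⟨(α, β) :: L, ?_, ?_, ?_, ?_, ?_, ?_⟩
  · simpa [hd] using hL.disjoint
  · simpa [hcard] using hL.card_add
  · simp only [List.mem_cons, forall_eq_or_imp]
    exact ⟨by omega, hL.card_le⟩
  · simp only [List.mem_cons, forall_eq_or_imp]
    refine ⟨fun x hx => ?_, fun p hp x hx => hXY _ (by simpa using hc) (hL.vertex p hp x hx)⟩
    rw [memY, mem_join_boundary_simplex hd]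
    right
    exact ⟨Finset.singleton_nonempty x, Finset.singleton_subset_iff.2 hx,
      Or.inl (small _ (by simpa using hc))⟩
  -- Sets in the older intervals are empty or faces of `X`, and `β` is a nonempty nonface of `X`, so
  -- none of them contains `β`.
  · refine List.pairwise_cons.2 ⟨fun q hq σ hσ h1 h2 h3 => ?_, hL.pairwise⟩
    rcases (hL.mem_iff σ hσ).2 ⟨q, hq, h1, h2⟩ with h | h
    · subst h
      exact hβ0 (Finset.subset_empty.1 h3)
    · exact (memI β hβ Finset.subset_union_right).1 (X.mem_mono h h3 hβ) subset_rfl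
  · intro σ hσ
    simp only [List.mem_cons, exists_eq_or_imp, ← hL.mem_iff σ hσ]
    constructor
    · rintro (h | h)
      · exact Or.inr (Or.inl h)
      rcases (memY σ).1 h with h | h
      · exact Or.inr (Or.inr h.1)
      · rw [mem_join_boundary_simplex hd] at h
        by_cases hb : β ⊆ σ
        · exact Or.inl ⟨hb, h.2.1⟩
        · exact Or.inr (Or.inr ((memI σ h.1 h.2.1).2 hb))
    · rintro (h | h | h)
      · right
        rw [memY, mem_join_boundary_simplex hd]
        exact Or.inr ⟨hβ.mono h.1, h.2, Or.inl (small σ hσ)⟩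
      · exact Or.inl h
      · exact Or.inr (hXY σ hσ h)

/-- All vertices in the intervals are vertices of the image complex, where the relabelling has an
inverse `g`, so the intervals can be pulled back along `g`. -/
theorem IsSkeletonShelling.of_map {W : Type*} [DecidableEq W]
    {X : PreAbstractSimplicialComplex V} {f : V → W} (hf : Set.InjOn f {v | {v} ∈ X})
    {d k c : ℕ} {L : List (Finset W × Finset W)}
    (hL : (X.map f).IsSkeletonShelling d k c L) :
    ∃ L', X.IsSkeletonShelling d k c L' := by
  -- `Function.invFunOn` needs `V` nonempty. If it is empty there is no such `L`: the empty face
  -- lies in some interval, and that interval has `d + 1` vertices.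
  rcases isEmpty_or_nonempty V with hV | hV
  · by_cases hLn : L = []
    · subst hLn
      have := (hL.mem_iff ∅ (by simp)).1 (Or.inl rfl)
      simp at this
    · obtain ⟨p, hp⟩ := List.exists_mem_of_ne_nil L hLn
      have h1 := hL.card_add p hp
      have : (p.1 ∪ p.2).Nonempty := by
        rw [← Finset.card_pos, Finset.card_union_of_disjoint (hL.disjoint p hp)]
        omega
      obtain ⟨x, hx⟩ := this
      obtain ⟨s, hs, hs'⟩ := hL.vertex p hp x hx
      obtain ⟨v, -⟩ := X.nonempty_of_mem hs
      exact hV.elim v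
  let g : W → V := Function.invFunOn f {v | {v} ∈ X}
  have hfg : ∀ x, {x} ∈ X.map f → {g x} ∈ X ∧ f (g x) = x := fun x hx => by
    obtain ⟨s, hs, hs'⟩ := hx
    obtain ⟨v, hv⟩ := X.nonempty_of_mem hs
    have hvX : {v} ∈ X := X.mem_mono hs (Finset.singleton_subset_iff.2 hv) (by simp)
    have hfv : f v = x := by
      have : f v ∈ s.image f := Finset.mem_image_of_mem f hv
      simpa [hs'] using this
    have hex : ∃ a ∈ {v | {v} ∈ X}, f a = x := ⟨v, hvX, hfv⟩
    exact ⟨Function.invFunOn_mem hex, Function.invFunOn_eq hex⟩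
  have hgf : ∀ v, {v} ∈ X → g (f v) = v := fun v hv => by
    have hex : ∃ a ∈ {v | {v} ∈ X}, f a = f v := ⟨v, hv, rfl⟩
    exact hf (Function.invFunOn_mem hex) hv (Function.invFunOn_eq hex)
  have hgi : ∀ {a : Finset W}, (∀ x ∈ a, {x} ∈ X.map f) → Set.InjOn g a := fun {a} ha x hx y hy h => by
    rw [← (hfg x (ha x hx)).2, ← (hfg y (ha y hy)).2, h]
  have hfgi : ∀ {a : Finset W}, (∀ x ∈ a, {x} ∈ X.map f) → (a.image g).image f = a :=
    fun {a} ha => by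
      rw [Finset.image_image]
      ext x
      simp only [Finset.mem_image, Function.comp]
      constructor
      · rintro ⟨y, hy, rfl⟩
        rwa [(hfg y (ha y hy)).2]
      · exact fun hx => ⟨x, hx, (hfg x (ha x hx)).2⟩
  have hgfi : ∀ {s : Finset V}, (∀ x ∈ s, {x} ∈ X) → (s.image f).image g = s :=
    fun {s} hs => by
      rw [Finset.image_image]
      ext x
      simp only [Finset.mem_image, Function.comp]
      constructor
      · rintro ⟨y, hy, rfl⟩
        rwa [hgf y (hs y hy)]
      · exact fun hx => ⟨x, hx, hgf x (hs x hx)⟩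
  have hv1 : ∀ p ∈ L, ∀ x ∈ p.1, {x} ∈ X.map f := fun p hp x hx =>
    hL.vertex p hp x (Finset.mem_union_left _ hx)
  have hv2 : ∀ p ∈ L, ∀ x ∈ p.2, {x} ∈ X.map f := fun p hp x hx =>
    hL.vertex p hp x (Finset.mem_union_right _ hx)
  have hX : ∀ s ∈ X, ∀ x ∈ s, {x} ∈ X := fun s hs x hx =>
    X.mem_mono hs (Finset.singleton_subset_iff.2 hx) (by simp)
  have hverts : ∀ p ∈ L, ∀ x ∈ p.1.image g ∪ p.2.image g, {x} ∈ X := fun p hp x hx => by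
    rw [← Finset.image_union, Finset.mem_image] at hx
    obtain ⟨y, hy, rfl⟩ := hx
    exact (hfg y (hL.vertex p hp y hy)).1
  have hpair : ∀ p ∈ L, ∀ s : Finset V, (p.2.image g ⊆ s ∧ s ⊆ p.1.image g ∪ p.2.image g) →
      (p.2 ⊆ s.image f ∧ s.image f ⊆ p.1 ∪ p.2) := fun p hp s hs => by
    constructor
    · rw [← hfgi (hv2 p hp)]
      exact Finset.image_subset_image hs.1
    · rw [← hfgi (hL.vertex p hp)]
      refine Finset.image_subset_image ?_
      rw [Finset.image_union]
      exact hs.2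
  refine ⟨L.map fun p => (p.1.image g, p.2.image g), ?_, ?_, ?_, ?_, ?_, ?_⟩
  · simp only [List.mem_map, forall_exists_index, and_imp, forall_apply_eq_imp_iff₂]
    intro p hp
    refine Finset.disjoint_left.2 fun x hx hx' => ?_
    obtain ⟨y, hy, rfl⟩ := Finset.mem_image.1 hx
    obtain ⟨z, hz, hyz⟩ := Finset.mem_image.1 hx'
    have := hgi (hL.vertex p hp) (Finset.mem_coe.2 (Finset.mem_union_right _ hz))
      (Finset.mem_coe.2 (Finset.mem_union_left _ hy)) hyz
    subst this
    exact Finset.disjoint_left.1 (hL.disjoint p hp) hy hz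
  · simp only [List.mem_map, forall_exists_index, and_imp, forall_apply_eq_imp_iff₂]
    intro p hp
    rw [Finset.card_image_of_injOn (hgi (hv1 p hp)), Finset.card_image_of_injOn (hgi (hv2 p hp))]
    exact hL.card_add p hp
  · simp only [List.mem_map, forall_exists_index, and_imp, forall_apply_eq_imp_iff₂]
    exact fun p hp => Finset.card_image_le.trans (hL.card_le p hp)
  · simp only [List.mem_map, forall_exists_index, and_imp, forall_apply_eq_imp_iff₂]
    exact hverts
  · rw [List.pairwise_map]
    refine hL.pairwise.imp_of_mem fun {p q} hp hq h σ hσ h1 h2 h3 => ?_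
    have := hpair q hq σ ⟨h1, h2⟩
    refine h (σ.image f) (Finset.card_image_le.trans hσ) this.1 this.2 ?_
    rw [← hfgi (hv2 p hp)]
    exact Finset.image_subset_image h3
  · intro σ hσ
    simp only [List.mem_map, exists_exists_and_eq_and]
    constructor
    · intro h
      have hσX : ∀ x ∈ σ, {x} ∈ X := by
        rcases h with rfl | h
        · simp
        · exact hX σ h
      have h' : σ.image f = ∅ ∨ σ.image f ∈ X.map f := by
        rcases h with rfl | h
        · simp
        · exact Or.inr ⟨σ, h, rfl⟩
      obtain ⟨p, hp, h1, h2⟩ := (hL.mem_iff _ (Finset.card_image_le.trans hσ)).1 h'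
      refine ⟨p, hp, ?_, ?_⟩
      · rw [← hgfi hσX]
        exact Finset.image_subset_image h1
      · rw [← hgfi hσX, ← Finset.image_union]
        exact Finset.image_subset_image h2
    · rintro ⟨p, hp, h1, h2⟩
      have hσX : ∀ x ∈ σ, {x} ∈ X := fun x hx => hverts p hp x (h2 hx)
      have := hpair p hp σ ⟨h1, h2⟩
      rcases (hL.mem_iff (σ.image f) (Finset.card_image_le.trans hσ)).2 ⟨p, hp, this⟩ with h | h
      · exact Or.inl (Finset.image_eq_empty.1 h)
      · obtain ⟨s, hs, hs'⟩ := h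
        right
        rw [← hgfi hσX, ← hs']
        change (s.image f).image g ∈ X
        rwa [hgfi (hX s hs)]

/-- The faces of a stellated sphere of low dimension are partitioned by intervals. -/
theorem IsStellatedSphere.exists_isSkeletonShelling {X : PreAbstractSimplicialComplex V}
    {d k c : ℕ} (h : IsStellatedSphere d k X) (hc : 1 ≤ c) (hck : c + k ≤ d) :
    ∃ L, X.IsSkeletonShelling d k c L := by
  obtain ⟨f, hf, hr⟩ := h
  have : ∃ L, (X.map f).IsSkeletonShelling d k c L := by
    generalize X.map f = Y at hr
    induction hr with
    | refl => exact ⟨_, isSkeletonShelling_simplexBoundary (by simp) (by omega) (by omega)⟩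
    | tail _ h ih =>
      obtain ⟨L, hL⟩ := ih
      exact hL.bistellarMove hc hck h
  obtain ⟨L, hL⟩ := this
  exact hL.of_map hf

end Shelling

end PreAbstractSimplicialComplex

namespace PreAbstractSimplicialComplex

/-! ### Triangular blocks of incidence matrices from interval partitions -/

section Triangular

theorem alternating_sum_succ (f : ℕ → ℤ) (l : ℕ) :
    ∑ u ∈ Finset.range (l + 2), (-1) ^ (l + 1 - u) * f u =
      f (l + 1) - ∑ u ∈ Finset.range (l + 1), (-1) ^ (l - u) * f u := by
  rw [Finset.sum_range_succ, Nat.sub_self, pow_zero, one_mul, add_comm, sub_eq_add_neg,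
    ← Finset.sum_neg_distrib]
  congr 1
  refine Finset.sum_congr rfl fun u hu => ?_
  rw [Nat.sub_add_comm (Nat.lt_succ_iff.1 (Finset.mem_range.1 hu)), pow_succ]
  ring

theorem alternating_sum_choose_succ (c l : ℕ) :
    ∑ u ∈ Finset.range (l + 1), (-1 : ℤ) ^ (l - u) * ((c + 1).choose u : ℤ) = c.choose l := by
  induction l with
  | zero => simp
  | succ l ih =>
    rw [alternating_sum_succ (fun u => ((c + 1).choose u : ℤ)), ih, Nat.choose_succ_succ]
    push_cast
    ring

theorem alternating_sum_choose_zero (l : ℕ) :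
    ∑ u ∈ Finset.range (l + 1), (-1 : ℤ) ^ (l - u) * ((0 : ℕ).choose u : ℤ) = (-1) ^ l := by
  rw [Finset.sum_range_succ']
  simp

theorem alternating_sum_shift (f : ℕ → ℤ) {b l : ℕ} (hbl : b ≤ l) :
    ∑ u ∈ Finset.range (l + 1), (-1) ^ (l - u) * (if b ≤ u then f (u - b) else 0) =
      ∑ u ∈ Finset.range (l - b + 1), (-1) ^ (l - b - u) * f u := by
  obtain ⟨m, rfl⟩ := Nat.exists_eq_add_of_le hbl
  rw [add_assoc, Finset.sum_range_add, Finset.sum_eq_zero, zero_add, Nat.add_sub_cancel_left]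
  · refine Finset.sum_congr rfl fun u hu => ?_
    rw [if_pos (Nat.le_add_right _ _), Nat.add_sub_cancel_left, Nat.add_sub_add_left]
  · intro u hu
    rw [if_neg (by simpa using hu), mul_zero]

variable {V : Type*}

/-- The pairs `(σ, τ)` in `C` index a square submatrix, which is triangular, of the incidence matrix
of sets with `s` elements and sets with `s + 1` elements. -/
def IsTriangular (s : ℕ) (C : List (Finset V × Finset V)) : Prop :=
  (∀ x ∈ C, x.1 ⊆ x.2 ∧ x.1.card = s ∧ x.2.card = s + 1) ∧ C.Pairwise fun x y => ¬ x.1 ⊆ y.2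

theorem IsTriangular.append {s : ℕ} {C D : List (Finset V × Finset V)} (hC : IsTriangular s C)
    (hD : IsTriangular s D) (h : ∀ x ∈ C, ∀ y ∈ D, ¬ x.1 ⊆ y.2) : IsTriangular s (C ++ D) := by
  refine ⟨fun x hx => ?_, List.pairwise_append.2 ⟨hC.2, hD.2, h⟩⟩
  rcases List.mem_append.1 hx with hx | hx
  exacts [hC.1 x hx, hD.1 x hx]

variable [DecidableEq V]

/-- The number of sets with `u` elements in the part in `A` of the interval `[β, α ∪ β]`. -/
theorem card_interval (α β A : Finset V) (h : Disjoint α β) (u : ℕ) :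
    ((A.powersetCard u).filter fun σ => β ⊆ σ ∧ σ ⊆ α ∪ β).card =
      if β ⊆ A then (if β.card ≤ u then (α ∩ A).card.choose (u - β.card) else 0) else 0 := by
  split_ifs with h1 h2
  · rw [← Finset.card_powersetCard]
    symm
    have hdis : ∀ γ : Finset V, γ ⊆ α ∩ A → Disjoint β γ := fun γ hγ =>
      (Finset.disjoint_of_subset_left (hγ.trans Finset.inter_subset_left) h).symm
    refine Finset.card_bij (fun γ _ => β ∪ γ) ?_ ?_ ?_
    · intro γ hγ
      rw [Finset.mem_powersetCard] at hγ
      simp only [Finset.mem_filter, Finset.mem_powersetCard]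
      refine ⟨⟨Finset.union_subset h1 (hγ.1.trans Finset.inter_subset_right), ?_⟩,
        Finset.subset_union_left, ?_⟩
      · rw [Finset.card_union_of_disjoint (hdis γ hγ.1), hγ.2]
        omega
      · exact Finset.union_subset Finset.subset_union_right
          ((hγ.1.trans Finset.inter_subset_left).trans Finset.subset_union_left)
    · intro γ hγ γ' hγ' he
      rw [Finset.mem_powersetCard] at hγ hγ'
      rw [← Finset.union_sdiff_cancel_left (hdis γ hγ.1),
        ← Finset.union_sdiff_cancel_left (hdis γ' hγ'.1), he]
    · intro σ hσ
      simp only [Finset.mem_filter, Finset.mem_powersetCard] at hσ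
      refine ⟨σ \ β, ?_, ?_⟩
      · rw [Finset.mem_powersetCard, Finset.card_sdiff_of_subset hσ.2.1, hσ.1.2]
        refine ⟨fun x hx => ?_, rfl⟩
        rw [Finset.mem_sdiff] at hx
        have := hσ.2.2 hx.1
        rw [Finset.mem_union] at this
        exact Finset.mem_inter.2 ⟨this.resolve_right hx.2, hσ.1.1 hx.1⟩
      · exact Finset.union_sdiff_of_subset hσ.2.1
  · rw [Finset.card_eq_zero, Finset.filter_eq_empty_iff]
    rintro σ hσ ⟨h3, -⟩
    rw [Finset.mem_powersetCard] at hσ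
    have := Finset.card_le_card h3
    omega
  · rw [Finset.card_eq_zero, Finset.filter_eq_empty_iff]
    rintro σ hσ ⟨h3, -⟩
    rw [Finset.mem_powersetCard] at hσ
    exact h1 (h3.trans hσ.1)

/-- Inside `A` the interval is `[β, β ∪ (α ∩ A)]`, or empty if `β` is not in `A`. Toggling a fixed
`a ∈ α ∩ A` cancels everything in the alternating count except the `l`-sets without `a`, which are
the rows of the block. If `α ∩ A` is empty there is nothing to toggle and `β` alone is counted. -/
theorem exists_isTriangular_interval (l : ℕ) (α β A : Finset V) (h : Disjoint α β) :
    ∃ C : List (Finset V × Finset V), IsTriangular l C ∧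
      (∀ x ∈ C, β ⊆ x.1 ∧ x.2 ⊆ A ∧ x.2 ⊆ α ∪ β) ∧
      ∑ u ∈ Finset.range (l + 1), (-1 : ℤ) ^ (l - u) *
          ((A.powersetCard u).filter fun σ => β ⊆ σ ∧ σ ⊆ α ∪ β).card =
        C.length + if β ⊆ A ∧ Disjoint α A ∧ β.card ≤ l then (-1) ^ (l - β.card) else 0 := by
  simp only [card_interval α β A h]
  by_cases h1 : β ⊆ A
  swap
  · exact ⟨[], ⟨by simp, by simp⟩, by simp, by simp [h1]⟩
  by_cases h2 : β.card ≤ l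
  swap
  · refine ⟨[], ⟨by simp, by simp⟩, by simp, ?_⟩
    simp only [h1, h2, and_false, if_false, if_true, List.length_nil, Nat.cast_zero, add_zero]
    refine Finset.sum_eq_zero fun u hu => ?_
    rw [Finset.mem_range] at hu
    rw [if_neg (by omega), Nat.cast_zero, mul_zero]
  simp only [h1, h2, if_true, true_and, and_true, Nat.cast_ite, Nat.cast_zero]
  rw [alternating_sum_shift (fun u => ((α ∩ A).card.choose u : ℤ)) h2]
  rcases Finset.eq_empty_or_nonempty (α ∩ A) with h3 | ⟨a, ha⟩
  · refine ⟨[], ⟨by simp, by simp⟩, by simp, ?_⟩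
    rw [h3, Finset.card_empty, alternating_sum_choose_zero,
      if_pos (Finset.disjoint_iff_inter_eq_empty.2 h3)]
    simp
  · have hnd : ¬ Disjoint α A := fun hd => by
      rw [Finset.disjoint_iff_inter_eq_empty.1 hd] at ha
      simp at ha
    have haα := (Finset.mem_inter.1 ha).1
    have haA := (Finset.mem_inter.1 ha).2
    have haβ : a ∉ β := Finset.disjoint_left.1 h haα
    have hdis : ∀ γ : Finset V, γ ⊆ (α ∩ A).erase a → Disjoint β γ := fun γ hγ =>
      (Finset.disjoint_of_subset_left
        ((hγ.trans (Finset.erase_subset _ _)).trans Finset.inter_subset_left) h).symm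
    have haγ : ∀ γ : Finset V, γ ⊆ (α ∩ A).erase a → a ∉ γ := fun γ hγ h' => by
      simpa using hγ h'
    -- A row `β ∪ γ` lies in a column `insert a (β ∪ γ')` only if `γ ⊆ γ'`, that is `γ = γ'` by
    -- cardinality; the block is even diagonal.
    refine ⟨(((α ∩ A).erase a).powersetCard (l - β.card)).toList.map
      fun γ => (β ∪ γ, insert a (β ∪ γ)), ⟨?_, ?_⟩, ?_, ?_⟩
    · intro x hx
      obtain ⟨γ, hγ, rfl⟩ := List.mem_map.1 hx
      obtain ⟨h4, h5⟩ := Finset.mem_powersetCard.1 (Finset.mem_toList.1 hγ)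
      have : (β ∪ γ).card = l := by
        rw [Finset.card_union_of_disjoint (hdis γ h4)]
        omega
      refine ⟨Finset.subset_insert _ _, this, ?_⟩
      rw [Finset.card_insert_of_notMem, this]
      simp [haβ, haγ γ h4]
    · rw [List.pairwise_map]
      refine (Finset.nodup_toList _).imp_of_mem fun {γ γ'} hγ hγ' hne hs => hne ?_
      rw [Finset.mem_toList, Finset.mem_powersetCard] at hγ hγ'
      refine Finset.eq_of_subset_of_card_le (fun x hx => ?_) (by rw [hγ.2, hγ'.2])
      have := hs (Finset.mem_union_right _ hx)
      rw [Finset.mem_insert, Finset.mem_union] at this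
      rcases this with rfl | h' | h'
      · exact absurd hx (haγ γ hγ.1)
      · exact absurd hx (Finset.disjoint_left.1 (hdis γ hγ.1) h')
      · exact h'
    · intro x hx
      obtain ⟨γ, hγ, rfl⟩ := List.mem_map.1 hx
      obtain ⟨h4, h5⟩ := Finset.mem_powersetCard.1 (Finset.mem_toList.1 hγ)
      have h6 : γ ⊆ α ∩ A := h4.trans (Finset.erase_subset _ _)
      refine ⟨Finset.subset_union_left, ?_, ?_⟩
      · exact Finset.insert_subset haA
          (Finset.union_subset h1 (h6.trans Finset.inter_subset_right))
      · exact Finset.insert_subset (Finset.mem_union_left _ haα)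
          (Finset.union_subset Finset.subset_union_right
            ((h6.trans Finset.inter_subset_left).trans Finset.subset_union_left))
    · rw [if_neg hnd, add_zero, List.length_map, Finset.length_toList, Finset.card_powersetCard,
        ← alternating_sum_choose_succ, Finset.card_erase_add_one ha]

theorem card_filter_exists_cons {c : ℕ} {p : Finset V × Finset V}
    {L : List (Finset V × Finset V)}
    (hp : ∀ q ∈ L, ∀ σ : Finset V, σ.card ≤ c → q.2 ⊆ σ → σ ⊆ q.1 ∪ q.2 → ¬ p.2 ⊆ σ)
    (A : Finset V) {u : ℕ} (hu : u ≤ c) :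
    ((A.powersetCard u).filter fun σ => ∃ q ∈ p :: L, q.2 ⊆ σ ∧ σ ⊆ q.1 ∪ q.2).card =
      ((A.powersetCard u).filter fun σ => p.2 ⊆ σ ∧ σ ⊆ p.1 ∪ p.2).card +
      ((A.powersetCard u).filter fun σ => ∃ q ∈ L, q.2 ⊆ σ ∧ σ ⊆ q.1 ∪ q.2).card := by
  rw [← Finset.card_union_of_disjoint, ← Finset.filter_or]
  · simp only [List.mem_cons, exists_eq_or_imp]
  · rw [Finset.disjoint_filter]
    rintro σ hσ ⟨h1, -⟩ ⟨q, hq, h2, h3⟩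
    exact hp q hq σ ((Finset.mem_powersetCard.1 hσ).2.trans_le hu) h2 h3 h1

/-- A complex whose skeleton is partitioned by intervals has large triangular matrices in
the boundary matrices of its induced subcomplexes. -/
theorem exists_isTriangular_of_pairwise {c l : ℕ} (hlc : l + 1 ≤ c)
    (L : List (Finset V × Finset V)) (hd : ∀ p ∈ L, Disjoint p.1 p.2)
    (hL : L.Pairwise fun p q =>
      ∀ σ : Finset V, σ.card ≤ c → q.2 ⊆ σ → σ ⊆ q.1 ∪ q.2 → ¬ p.2 ⊆ σ) (A : Finset V) :
    ∃ C : List (Finset V × Finset V), IsTriangular l C ∧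
      (∀ x ∈ C, x.2 ⊆ A ∧ ∃ q ∈ L, q.2 ⊆ x.2 ∧ x.2 ⊆ q.1 ∪ q.2) ∧
      ∑ u ∈ Finset.range (l + 1), (-1 : ℤ) ^ (l - u) *
          ((A.powersetCard u).filter fun σ => ∃ q ∈ L, q.2 ⊆ σ ∧ σ ⊆ q.1 ∪ q.2).card =
        C.length + (L.map fun q =>
          if q.2 ⊆ A ∧ Disjoint q.1 A ∧ q.2.card ≤ l then (-1 : ℤ) ^ (l - q.2.card) else 0).sum := by
  induction L with
  | nil => exact ⟨[], ⟨by simp, by simp⟩, by simp, by simp⟩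
  | cons p L ih =>
    rw [List.pairwise_cons] at hL
    obtain ⟨C, hC, hCL, hsum⟩ := ih (fun q hq => hd q (List.mem_cons_of_mem _ hq)) hL.2
    obtain ⟨D, hD, hDp, hsum'⟩ :=
      exists_isTriangular_interval l p.1 p.2 A (hd p List.mem_cons_self)
    -- Rows in `D` contain `p.2`, while columns in `C` lie in later intervals of the list and so do
    -- not; `l + 1 ≤ c` makes the pairwise condition apply to these columns.
    refine ⟨D ++ C, hD.append hC fun x hx y hy hxy => ?_, fun x hx => ?_, ?_⟩
    · obtain ⟨-, q, hq, h1, h2⟩ := hCL y hy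
      exact hL.1 q hq y.2 ((hC.1 y hy).2.2.trans_le hlc) h1 h2 ((hDp x hx).1.trans hxy)
    · rcases List.mem_append.1 hx with h | h
      · have := hDp x h
        exact ⟨this.2.1, p, List.mem_cons_self, this.1.trans (hD.1 x h).1, this.2.2⟩
      · obtain ⟨h1, q, hq, h2⟩ := hCL x h
        exact ⟨h1, q, List.mem_cons_of_mem _ hq, h2⟩
    · rw [List.map_cons, List.sum_cons, List.length_append, Nat.cast_add]
      have : ∀ u ∈ Finset.range (l + 1), (-1 : ℤ) ^ (l - u) * ((A.powersetCard u).filter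
          fun σ => ∃ q ∈ p :: L, q.2 ⊆ σ ∧ σ ⊆ q.1 ∪ q.2).card = _ := fun u hu => by
        rw [card_filter_exists_cons hL.1 A (by rw [Finset.mem_range] at hu; omega), Nat.cast_add,
          mul_add]
      rw [Finset.sum_congr rfl this, Finset.sum_add_distrib, hsum, hsum']
      ring

/-- The number of faces in a skeleton which is partitioned by intervals. -/
theorem card_filter_exists_of_pairwise {c u D : ℕ} (huc : u ≤ c)
    (L : List (Finset V × Finset V)) (hd : ∀ p ∈ L, Disjoint p.1 p.2)
    (hL : L.Pairwise fun p q =>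
      ∀ σ : Finset V, σ.card ≤ c → q.2 ⊆ σ → σ ⊆ q.1 ∪ q.2 → ¬ p.2 ⊆ σ) {A : Finset V}
    (hA : ∀ p ∈ L, p.1 ∪ p.2 ⊆ A) (hD : ∀ p ∈ L, p.1.card + p.2.card = D) :
    ((A.powersetCard u).filter fun σ => ∃ q ∈ L, q.2 ⊆ σ ∧ σ ⊆ q.1 ∪ q.2).card =
      (L.map fun q => if q.2.card ≤ u then (D - q.2.card).choose (u - q.2.card) else 0).sum := by
  induction L with
  | nil => simp
  | cons p L ih =>
    rw [List.pairwise_cons] at hL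
    rw [card_filter_exists_cons hL.1 A huc, card_interval _ _ _ (hd p List.mem_cons_self),
      List.map_cons, List.sum_cons, ih (fun q hq => hd q (List.mem_cons_of_mem _ hq)) hL.2
        (fun q hq => hA q (List.mem_cons_of_mem _ hq))
        (fun q hq => hD q (List.mem_cons_of_mem _ hq)),
      if_pos (Finset.subset_union_right.trans (hA p List.mem_cons_self)),
      Finset.inter_eq_left.2 (Finset.subset_union_left.trans (hA p List.mem_cons_self)),
      ← hD p List.mem_cons_self, Nat.add_sub_cancel]

end Triangular

end PreAbstractSimplicialComplex

namespace PreAbstractSimplicialComplex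

/-! ### Adding vertices one by one, and random orderings -/

section Orderings

variable {V : Type*} [LinearOrder V]

open scoped Classical in
/-- Building a complex vertex by vertex, in the order given by `key`, the partitions of the
skeletons of the links yield a large triangular matrix in the boundary matrix. -/
theorem exists_isTriangular_of_links (M : PreAbstractSimplicialComplex V) {d k c l : ℕ}
    (hlc : l + 1 ≤ c) {W : Finset V} (hW : ∀ v ∈ W, {v} ∈ M)
    {L : V → List (Finset V × Finset V)}
    (hL : ∀ v ∈ W, (M.link v).IsSkeletonShelling d k c (L v))
    {key : V → V} (hkey : Function.Injective key) :
    ∃ C : List (Finset V × Finset V), IsTriangular (l + 1) C ∧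
      (∀ x ∈ C, x.2 ⊆ W ∧ x.2 ∈ M) ∧
      ∑ u ∈ Finset.range (l + 1), (-1 : ℤ) ^ (l - u) *
          ((W.powersetCard (u + 1)).filter (· ∈ M)).card =
        C.length + ∑ v ∈ W, ((L v).map fun q =>
          if q.2 ⊆ W.filter (key · < key v) ∧ Disjoint q.1 (W.filter (key · < key v)) ∧
            q.2.card ≤ l then (-1 : ℤ) ^ (l - q.2.card) else 0).sum := by
  induction W using Finset.induction_on_max_value key with
  | empty =>
    have h (u : ℕ) : (∅ : Finset V).powersetCard (u + 1) = ∅ :=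
      Finset.powersetCard_eq_empty.2 (by simp)
    exact ⟨[], ⟨by simp, by simp⟩, by simp, by simp [h]⟩
  | insert a s has hmax ih =>
    obtain ⟨C, hC, hCM, hsum⟩ := ih (fun v hv => hW v (Finset.mem_insert_of_mem hv))
      (fun v hv => hL v (Finset.mem_insert_of_mem hv))
    have hmax' : ∀ x ∈ s, key x < key a := fun x hx =>
      lt_of_le_of_ne (hmax x hx) fun h => has (hkey h ▸ hx)
    have haL := hL a (Finset.mem_insert_self a s)
    have hmem : ∀ σ : Finset V, σ ⊆ s → σ.card ≤ c →
        (insert a σ ∈ M ↔ ∃ q ∈ L a, q.2 ⊆ σ ∧ σ ⊆ q.1 ∪ q.2) := fun σ hσ hσc => by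
      rw [← haL.mem_iff σ hσc, mem_link]
      rcases Finset.eq_empty_or_nonempty σ with rfl | h
      · simpa using hW a (Finset.mem_insert_self a s)
      · have : a ∉ σ := fun h => has (hσ h)
        simp [h, h.ne_empty, this]
    obtain ⟨D, hD, hDM, hsum'⟩ :=
      exists_isTriangular_of_pairwise hlc (L a) haL.disjoint haL.pairwise s
    -- Coning the block of the link of `a` with `a` raises all sizes by one. Its rows contain `a`
    -- and the older columns do not, so the concatenation stays triangular.
    refine ⟨D.map (fun x => (insert a x.1, insert a x.2)) ++ C, IsTriangular.append ⟨?_, ?_⟩ hC ?_,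
      ?_, ?_⟩
    · intro x hx
      obtain ⟨y, hy, rfl⟩ := List.mem_map.1 hx
      have h1 := hD.1 y hy
      have h2 : a ∉ y.2 := fun h => has ((hDM y hy).1 h)
      refine ⟨Finset.insert_subset_insert _ h1.1, ?_, ?_⟩
      · rw [Finset.card_insert_of_notMem (fun h => h2 (h1.1 h)), h1.2.1]
      · rw [Finset.card_insert_of_notMem h2, h1.2.2]
    · rw [List.pairwise_map]
      refine hD.2.imp_of_mem fun {x y} hx hy h h' => h fun z hz => ?_
      have := h' (Finset.mem_insert_of_mem hz)
      refine (Finset.mem_insert.1 this).resolve_left fun hza => ?_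
      exact has ((hDM x hx).1 ((hD.1 x hx).1 (hza ▸ hz)))
    · intro x hx y hy hxy
      obtain ⟨z, hz, rfl⟩ := List.mem_map.1 hx
      exact has ((hCM y hy).1 (hxy (Finset.mem_insert_self _ _)))
    · intro x hx
      rcases List.mem_append.1 hx with h | h
      · obtain ⟨y, hy, rfl⟩ := List.mem_map.1 h
        refine ⟨Finset.insert_subset_insert _ (hDM y hy).1, ?_⟩
        exact (hmem _ (hDM y hy).1 ((hD.1 y hy).2.2.trans_le hlc)).2 (hDM y hy).2
      · exact ⟨(hCM x h).1.trans (Finset.subset_insert _ _), (hCM x h).2⟩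
    · have hcount : ∀ u ∈ Finset.range (l + 1), (-1 : ℤ) ^ (l - u) *
          (((insert a s).powersetCard (u + 1)).filter (· ∈ M)).card =
          (-1 : ℤ) ^ (l - u) * ((s.powersetCard (u + 1)).filter (· ∈ M)).card +
          (-1 : ℤ) ^ (l - u) * ((s.powersetCard u).filter fun σ =>
            ∃ q ∈ L a, q.2 ⊆ σ ∧ σ ⊆ q.1 ∪ q.2).card := fun u hu => by
        rw [Finset.mem_range] at hu
        rw [← mul_add, ← Nat.cast_add, Finset.powersetCard_succ_insert has, Finset.filter_union,
          Finset.card_union_of_disjoint, Finset.filter_image, Finset.card_image_of_injOn]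
        · congr 4
          refine Finset.filter_congr fun σ hσ => ?_
          rw [Finset.mem_powersetCard] at hσ
          exact hmem σ hσ.1 (by omega)
        · intro σ hσ τ hτ h
          simp only [Finset.coe_filter, Finset.mem_powersetCard, Set.mem_ofPred_eq] at hσ hτ
          have h1 : a ∉ σ := fun h => has (hσ.1.1 h)
          have h2 : a ∉ τ := fun h => has (hτ.1.1 h)
          rw [← Finset.erase_insert h1, ← Finset.erase_insert h2, h]
        · rw [Finset.disjoint_left]
          intro σ hσ hσ'
          obtain ⟨τ, hτ, rfl⟩ := Finset.mem_image.1 (Finset.mem_filter.1 hσ').1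
          exact has ((Finset.mem_powersetCard.1 (Finset.mem_filter.1 hσ).1).1
            (Finset.mem_insert_self _ _))
      have ha : (insert a s).filter (key · < key a) = s := by
        ext x
        simp only [Finset.mem_filter, Finset.mem_insert]
        constructor
        · rintro ⟨rfl | h, h'⟩
          · exact absurd h' (lt_irrefl _)
          · exact h
        · exact fun h => ⟨Or.inr h, hmax' x h⟩
      have hv : ∀ v ∈ s, (insert a s).filter (key · < key v) = s.filter (key · < key v) :=
        fun v hv => by
          rw [Finset.filter_insert, if_neg (not_lt.2 (hmax v hv))]
      rw [Finset.sum_congr rfl hcount, Finset.sum_add_distrib, hsum, hsum', Finset.sum_insert has,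
        ha, List.length_append, List.length_map, Nat.cast_add]
      rw [Finset.sum_congr rfl fun v hv' => by rw [← hv v hv']]
      ring

/-- The probability, for a random ordering of `W`, that `v` comes after all elements of `β`
and before all elements of `α`. -/
theorem card_orderings_mul_factorial (W α : Finset V) {v : V} (hv : v ∈ W) (β : Finset V)
    (hα : α ⊆ W) (hβ : β ⊆ W) (hvα : v ∉ α) (hvβ : v ∉ β) (hd : Disjoint α β) :
    ((permsOfFinset W).filter fun p => (∀ x ∈ β, p x < p v) ∧ ∀ x ∈ α, p v < p x).card *
      (α.card + β.card + 1).factorial = W.card.factorial * α.card.factorial * β.card.factorial := by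
  induction α using Finset.induction_on generalizing β with
  | empty =>
    -- With `α` empty the event is that `v` is last in `insert v β`; composing with a transposition
    -- shows that every element is last equally often.
    have hswap : ∀ u ∈ insert v β, ((permsOfFinset W).filter fun p =>
        ∀ x ∈ insert v β, x ≠ u → p x < p u).card = ((permsOfFinset W).filter fun p =>
        ∀ x ∈ insert v β, x ≠ v → p x < p v).card := by
      intro u hu
      have huW : u ∈ W := by
        rcases Finset.mem_insert.1 hu with rfl | h
        exacts [hv, hβ h]
      have hmem : ∀ p ∈ permsOfFinset W, p * Equiv.swap u v ∈ permsOfFinset W := by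
        intro p hp
        rw [mem_perms_of_finset_iff] at hp ⊢
        intro x hx
        by_cases hxu : x = u
        · exact hxu ▸ huW
        by_cases hxv : x = v
        · exact hxv ▸ hv
        rw [Equiv.Perm.mul_apply, Equiv.swap_apply_of_ne_of_ne hxu hxv] at hx
        exact hp hx
      have hT : ∀ x ∈ insert v β, Equiv.swap u v x ∈ insert v β := by
        intro x hx
        rw [Equiv.swap_apply_def]
        split_ifs
        exacts [Finset.mem_insert_self _ _, hu, hx]
      refine Finset.card_bij (fun p _ => p * Equiv.swap u v) ?_ ?_ ?_
      · intro p hp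
        rw [Finset.mem_filter] at hp ⊢
        refine ⟨hmem p hp.1, fun x hx hxv => ?_⟩
        rw [Equiv.Perm.mul_apply, Equiv.Perm.mul_apply, Equiv.swap_apply_right]
        refine hp.2 _ (hT x hx) fun h => hxv ?_
        simpa using congrArg (Equiv.swap u v) h
      · intro p _ q _ h
        exact mul_right_cancel h
      · intro p hp
        rw [Finset.mem_filter] at hp
        refine ⟨p * Equiv.swap u v, ?_, ?_⟩
        · rw [Finset.mem_filter]
          refine ⟨hmem p hp.1, fun x hx hxv => ?_⟩
          rw [Equiv.Perm.mul_apply, Equiv.Perm.mul_apply, Equiv.swap_apply_left]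
          refine hp.2 _ (hT x hx) fun h => hxv ?_
          simpa using congrArg (Equiv.swap u v) h
        · rw [mul_assoc, Equiv.swap_mul_self, mul_one]
    have hsum := Finset.sum_card_bipartiteAbove_eq_sum_card_bipartiteBelow
      (s := insert v β) (t := permsOfFinset W)
      (fun u (p : Equiv.Perm V) => ∀ x ∈ insert v β, x ≠ u → p x < p u)
    have hone : ∀ p ∈ permsOfFinset W, ((insert v β).bipartiteBelow
        (fun u (p : Equiv.Perm V) => ∀ x ∈ insert v β, x ≠ u → p x < p u) p).card = 1 := by
      intro p _
      obtain ⟨u, hu, hmax⟩ := Finset.exists_max_image (insert v β) p ⟨v, Finset.mem_insert_self _ _⟩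
      rw [Finset.card_eq_one]
      refine ⟨u, ?_⟩
      ext w
      rw [Finset.mem_bipartiteBelow, Finset.mem_singleton]
      constructor
      · rintro ⟨hw, h⟩
        by_contra hne
        exact absurd (h u hu (Ne.symm hne)) (not_lt.2 (hmax w hw))
      · rintro rfl
        exact ⟨hu, fun x hx hne => lt_of_le_of_ne (hmax x hx) fun h => hne (p.injective h)⟩
    rw [Finset.sum_congr rfl hone] at hsum
    simp only [Finset.bipartiteAbove] at hsum
    rw [Finset.sum_congr rfl hswap, Finset.sum_const, Finset.sum_const,
      Finset.card_insert_of_notMem hvβ, card_perms_of_finset, smul_eq_mul, smul_eq_mul,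
      mul_one] at hsum
    have hset : ((permsOfFinset W).filter fun p =>
        (∀ x ∈ β, p x < p v) ∧ ∀ x ∈ (∅ : Finset V), p v < p x) = (permsOfFinset W).filter fun p =>
        ∀ x ∈ insert v β, x ≠ v → p x < p v := by
      refine Finset.filter_congr fun p _ => ?_
      constructor
      · rintro ⟨h, -⟩ x hx hne
        exact h x ((Finset.mem_insert.1 hx).resolve_left hne)
      · intro h
        exact ⟨fun x hx => h x (Finset.mem_insert_of_mem hx) fun h => hvβ (h ▸ hx), by simp⟩
    rw [hset, Finset.card_empty, zero_add, Nat.factorial_zero, mul_one, Nat.factorial_succ,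
      ← hsum]
    ring
  | insert x α hx ih =>
    have hxv : v ≠ x := fun h => hvα (h ▸ Finset.mem_insert_self _ _)
    have hxW : x ∈ W := hα (Finset.mem_insert_self _ _)
    have hα' : α ⊆ W := (Finset.subset_insert _ _).trans hα
    have hvα' : v ∉ α := fun h => hvα (Finset.mem_insert_of_mem h)
    rw [Finset.disjoint_insert_left] at hd
    have h1 := ih β hα' hβ hvα' hvβ hd.2
    have h2 := ih (insert x β) hα' (Finset.insert_subset hxW hβ) hvα' (by simp [hxv, hvβ])
      (Finset.disjoint_insert_right.2 ⟨hx, hd.2⟩)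
    classical
    -- The element `x` comes either after or before `v`, so the count for `insert x α` is the
    -- difference of two known counts.
    have hsplit : ((permsOfFinset W).filter fun p =>
        (∀ y ∈ β, p y < p v) ∧ ∀ y ∈ α, p v < p y).card =
        ((permsOfFinset W).filter fun p =>
          (∀ y ∈ β, p y < p v) ∧ ∀ y ∈ insert x α, p v < p y).card +
        ((permsOfFinset W).filter fun p =>
          (∀ y ∈ insert x β, p y < p v) ∧ ∀ y ∈ α, p v < p y).card := by
      rw [← Finset.card_union_of_disjoint, ← Finset.filter_or]
      · congr 1
        refine Finset.filter_congr fun p _ => ?_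
        have : p x < p v ∨ p v < p x :=
          lt_or_gt_of_ne fun h => hxv (p.injective h).symm
        simp only [Finset.forall_mem_insert]
        tauto
      · rw [Finset.disjoint_filter]
        rintro p - ⟨-, h⟩ ⟨h', -⟩
        exact lt_asymm (h x (Finset.mem_insert_self _ _)) (h' x (Finset.mem_insert_self _ _))
    rw [hsplit] at h1
    rw [Finset.card_insert_of_notMem hd.1, show α.card + (β.card + 1) + 1 =
      α.card + β.card + 1 + 1 by ring, Nat.factorial_succ (_ + 1),
      Nat.factorial_succ (Finset.card _)] at h2
    rw [Finset.card_insert_of_notMem hx, show α.card + 1 + β.card + 1 =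
      α.card + β.card + 1 + 1 by ring, Nat.factorial_succ (_ + 1),
      Nat.factorial_succ (Finset.card _)]
    zify at h1 h2 ⊢
    linear_combination (α.card + β.card + 1 + 1 : ℤ) * h1 - h2

theorem card_orderings_mul_choose (W α β : Finset V) {v : V} {d : ℕ} (hv : v ∈ W)
    (hα : α ⊆ W) (hβ : β ⊆ W) (hvα : v ∉ α) (hvβ : v ∉ β) (hd : Disjoint α β)
    (hcard : α.card + β.card = d + 1) :
    ((permsOfFinset W).filter fun p => (∀ x ∈ β, p x < p v) ∧ ∀ x ∈ α, p v < p x).card *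
      ((d + 2) * (d + 1).choose β.card) = W.card.factorial := by
  have h := card_orderings_mul_factorial W α hv β hα hβ hvα hvβ hd
  rw [hcard, Nat.factorial_succ] at h
  have h' := Nat.choose_mul_factorial_mul_factorial (n := d + 1) (k := β.card) (by omega)
  rw [show d + 1 - β.card = α.card by omega] at h'
  rw [← h'] at h
  have : 0 < α.card.factorial * β.card.factorial :=
    Nat.mul_pos (Nat.factorial_pos _) (Nat.factorial_pos _)
  refine Nat.eq_of_mul_eq_mul_right this ?_
  rw [← mul_assoc (W.card.factorial), ← h]
  ring

end Orderings

end PreAbstractSimplicialComplex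

namespace PreAbstractSimplicialComplex

/-! ### Identities for face numbers and `g`-numbers -/

section FaceNumbers

theorem choose_mul_choose_sub {D b u j : ℕ} (hbu : b ≤ u) (huj : u ≤ j) :
    (D - u).choose (j - u) * (D - b).choose (u - b) =
      (D - b).choose (j - b) * (j - b).choose (u - b) := by
  rw [Nat.choose_mul (by omega), mul_comm, show D - b - (u - b) = D - u by omega,
    show j - b - (u - b) = j - u by omega]

/-- An interval with minimum of size `b` and maximum of size `D` has size generating function `t^b
(1 + t)^(D - b)`, and this transform sends it to the single monomial of degree `b`. Hence the
transform counts the intervals by the size of their minimum. -/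
theorem alternating_sum_choose_mul_choose (D b j : ℕ) :
    ∑ u ∈ Finset.range (j + 1), (-1 : ℤ) ^ (j - u) * ((D - u).choose (j - u) : ℤ) *
      (if b ≤ u then ((D - b).choose (u - b) : ℤ) else 0) = if b = j then 1 else 0 := by
  by_cases hbj : b ≤ j
  · have h : ∀ u ∈ Finset.range (j + 1), (-1 : ℤ) ^ (j - u) * ((D - u).choose (j - u) : ℤ) *
        (if b ≤ u then ((D - b).choose (u - b) : ℤ) else 0) =
        ((D - b).choose (j - b) : ℤ) * ((-1 : ℤ) ^ (j - u) *
          (if b ≤ u then ((j - b).choose (u - b) : ℤ) else 0)) := fun u hu => by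
      split_ifs with hbu
      · have := choose_mul_choose_sub (D := D) hbu (Nat.lt_succ_iff.1 (Finset.mem_range.1 hu))
        zify at this
        linear_combination (-1 : ℤ) ^ (j - u) * this
      · simp
    rw [Finset.sum_congr rfl h, ← Finset.mul_sum,
      alternating_sum_shift (fun w => ((j - b).choose w : ℤ)) hbj]
    rcases hbj.eq_or_lt with rfl | h'
    · simp
    · obtain ⟨c, hc⟩ : ∃ c, j - b = c + 1 := ⟨j - b - 1, by omega⟩
      rw [if_neg h'.ne, hc, alternating_sum_choose_succ]
      simp
  · rw [if_neg (by omega)]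
    refine Finset.sum_eq_zero fun u hu => ?_
    rw [Finset.mem_range] at hu
    rw [if_neg (by omega), mul_zero]

theorem alternating_sum_map_choose {α : Type*} (L : List α) (b : α → ℕ) (D j : ℕ) :
    ∑ u ∈ Finset.range (j + 1), (-1 : ℤ) ^ (j - u) * ((D - u).choose (j - u) : ℤ) *
      ((L.map fun q => if b q ≤ u then (D - b q).choose (u - b q) else 0).sum : ℕ) =
      (L.map fun q => if b q = j then (1 : ℤ) else 0).sum := by
  induction L with
  | nil => simp
  | cons p L ih =>
    simp only [List.map_cons, List.sum_cons, Nat.cast_add, mul_add, Finset.sum_add_distrib, ih,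
      Nat.cast_ite, Nat.cast_zero]
    rw [alternating_sum_choose_mul_choose]

variable {V : Type*}

/-- By Pascal's rule, `g` is given by the formula for `h` with `d + 1` in place of `d`. -/
theorem gNumber_eq (M : PreAbstractSimplicialComplex V) {d j : ℕ} (hj : j ≤ d + 1) :
    M.gNumber d j = ∑ s ∈ Finset.range (j + 1),
      (-1) ^ (j - s) * ((d + 2 - s).choose (j - s) : ℤ) * M.faceCount s := by
  cases j with
  | zero => simp [gNumber, hNumber]
  | succ j =>
    rw [gNumber, hNumber, hNumber, Finset.sum_range_succ, Finset.sum_range_succ _ (j + 1),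
      add_sub_right_comm, ← Finset.sum_sub_distrib]
    congr 1
    · refine Finset.sum_congr rfl fun s hs => ?_
      rw [Finset.mem_range] at hs
      rw [show j + 1 - s = j - s + 1 by omega, show d + 2 - s = d + 1 - s + 1 by omega,
        Nat.choose_succ_succ, pow_succ]
      push_cast
      ring
    · simp

/-- The right side becomes the sum of the `g_j` of the vertex links, since `(u + 1) f_u` counts the
incidences of vertices with faces of `u + 1` elements. -/
theorem gNumber_succ_mul_add (M : PreAbstractSimplicialComplex V) {d j : ℕ} (hj : j ≤ d) :
    (j + 1 : ℤ) * M.gNumber d (j + 1) + (d + 2 - j) * M.gNumber d j =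
      ∑ u ∈ Finset.range (j + 1), (-1 : ℤ) ^ (j - u) * ((d + 1 - u).choose (j - u) : ℤ) *
        ((u + 1) * M.faceCount (u + 1)) := by
  have h1 : (j + 1 : ℤ) * M.gNumber d (j + 1) + (d + 2 - j) * M.gNumber d j =
      ∑ s ∈ Finset.range (j + 2), (-1 : ℤ) ^ (j + 1 - s) *
        ((d + 2 - s).choose (j + 1 - s) : ℤ) * (s * M.faceCount s) := by
    rw [gNumber_eq M (by omega), gNumber_eq M (by omega), Finset.sum_range_succ,
      Finset.sum_range_succ _ (j + 1), mul_add, add_right_comm, Finset.mul_sum, Finset.mul_sum,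
      ← Finset.sum_add_distrib]
    congr 1
    · refine Finset.sum_congr rfl fun s hs => ?_
      rw [Finset.mem_range] at hs
      have h := Nat.choose_succ_right_eq (d + 2 - s) (j - s)
      rw [show d + 2 - s - (j - s) = d + 2 - j by omega] at h
      rw [show j + 1 - s = j - s + 1 by omega, pow_succ]
      zify [show s ≤ j by omega, show j ≤ d + 2 by omega] at h
      linear_combination -(-1 : ℤ) ^ (j - s) * M.faceCount s * h
    · simp
  rw [h1, Finset.sum_range_succ']
  simp only [Nat.cast_zero, zero_mul, mul_zero, add_zero]
  refine Finset.sum_congr rfl fun u _ => ?_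
  rw [Nat.add_sub_add_right, show d + 2 - (u + 1) = d + 1 - u by omega]
  push_cast
  ring

/-- The probability attached to `|β| = j` turns the interval count into consecutive terms of one
sequence `g_j / C(d + 2, j)`, which makes the alternating sum over `j` telescope. -/
theorem gNumber_div_add_gNumber_div (M : PreAbstractSimplicialComplex V) {d j : ℕ} (hj : j ≤ d) :
    (((j + 1) * M.gNumber d (j + 1) + (d + 2 - j) * M.gNumber d j : ℤ) : ℚ) /
        ((d + 2) * (d + 1).choose j) =
      M.gNumber d (j + 1) / (d + 2).choose (j + 1) + M.gNumber d j / (d + 2).choose j := by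
  have h1 := Nat.add_one_mul_choose_eq (d + 1) j
  have h2 := Nat.choose_mul_succ_eq (d + 1) j
  have h3 : ((d + 1).choose j : ℚ) ≠ 0 := by
    have := Nat.choose_pos (n := d + 1) (k := j) (by omega)
    positivity
  have h4 : ((d + 2).choose (j + 1) : ℚ) ≠ 0 := by
    have := Nat.choose_pos (n := d + 2) (k := j + 1) (by omega)
    positivity
  have h5 : ((d + 2).choose j : ℚ) ≠ 0 := by
    have := Nat.choose_pos (n := d + 2) (k := j) (by omega)
    positivity
  have h6 : (d + 2 : ℚ) ≠ 0 := by positivity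
  have h1' : ((d + 2) * (d + 1).choose j : ℚ) = (d + 2).choose (j + 1) * (j + 1) := by
    exact_mod_cast h1
  have h2' : ((d + 2) * (d + 1).choose j : ℚ) = (d + 2).choose j * (d + 2 - j) := by
    have h : ((d + 2 - j : ℕ) : ℚ) = d + 2 - j := by
      rw [Nat.cast_sub (by omega)]; push_cast; ring
    rw [← h, mul_comm]
    exact_mod_cast h2
  push_cast
  rw [add_div]
  congr 1
  · rw [h1', div_eq_div_iff (by positivity) h4]
    ring
  · rw [h2', div_eq_div_iff (by rw [← h2']; positivity) h5]
    ring

open scoped Classical in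
theorem faceCount_succ_eq_card (M : PreAbstractSimplicialComplex V) {W : Finset V}
    (hW : ∀ v, v ∈ W ↔ {v} ∈ M) (u : ℕ) :
    M.faceCount (u + 1) = ((W.powersetCard (u + 1)).filter (· ∈ M)).card := by
  rw [faceCount, if_neg (Nat.succ_ne_zero u), ← Set.ncard_coe_finset]
  congr 1
  ext σ
  simp only [Finset.coe_filter, Finset.mem_powersetCard]
  constructor
  · rintro ⟨h1, h2⟩
    exact ⟨⟨fun x hx => (hW x).2
      (M.mem_mono h1 (Finset.singleton_subset_iff.2 hx) (by simp)), h2⟩, h1⟩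
  · rintro ⟨⟨-, h2⟩, h1⟩
    exact ⟨h1, h2⟩

theorem exists_vertexFinset {M : PreAbstractSimplicialComplex V} (hM : M.faces.Finite) :
    ∃ W : Finset V, ∀ v, v ∈ W ↔ {v} ∈ M := by
  have : {v : V | {v} ∈ M}.Finite := hM.preimage Finset.singleton_injective.injOn
  exact ⟨this.toFinset, fun v => by rw [Set.Finite.mem_toFinset]; rfl⟩

open scoped Classical in
theorem succ_mul_faceCount_succ [DecidableEq V] (M : PreAbstractSimplicialComplex V) {W : Finset V}
    (hW : ∀ v, v ∈ W ↔ {v} ∈ M) (u : ℕ) :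
    (u + 1) * M.faceCount (u + 1) =
      ∑ v ∈ W, ((W.powersetCard u).filter fun σ => σ = ∅ ∨ σ ∈ M.link v).card := by
  have h := Finset.sum_card_bipartiteAbove_eq_sum_card_bipartiteBelow (s := W)
    (t := (W.powersetCard (u + 1)).filter (· ∈ M)) (fun v σ => v ∈ σ)
  have h1 : ∀ σ ∈ (W.powersetCard (u + 1)).filter (· ∈ M),
      (W.bipartiteBelow (fun v σ => v ∈ σ) σ).card = u + 1 := fun σ hσ => by
    rw [Finset.mem_filter, Finset.mem_powersetCard] at hσ
    rw [Finset.bipartiteBelow, Finset.filter_mem_eq_inter, Finset.inter_eq_right.2 hσ.1.1, hσ.1.2]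
  rw [Finset.sum_congr rfl h1, Finset.sum_const, ← faceCount_succ_eq_card M hW, smul_eq_mul,
    mul_comm] at h
  rw [← h]
  refine Finset.sum_congr rfl fun v hv => ?_
  refine Finset.card_bij' (fun σ _ => σ.erase v) (fun σ _ => insert v σ) ?_ ?_ ?_ ?_
  · intro σ hσ
    rw [Finset.mem_bipartiteAbove, Finset.mem_filter, Finset.mem_powersetCard] at hσ
    rw [Finset.mem_filter, Finset.mem_powersetCard]
    refine ⟨⟨(Finset.erase_subset _ _).trans hσ.1.1.1, ?_⟩, ?_⟩
    · rw [Finset.card_erase_of_mem hσ.2, hσ.1.1.2, Nat.add_sub_cancel]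
    · rcases Finset.eq_empty_or_nonempty (σ.erase v) with h | h
      · exact Or.inl h
      · refine Or.inr ⟨h, Finset.notMem_erase _ _, ?_⟩
        rw [Finset.insert_erase hσ.2]
        exact hσ.1.2
  · intro σ hσ
    rw [Finset.mem_filter, Finset.mem_powersetCard] at hσ
    rw [Finset.mem_bipartiteAbove, Finset.mem_filter, Finset.mem_powersetCard]
    have hvσ : v ∉ σ := by
      rcases hσ.2 with rfl | h
      · simp
      · exact h.2.1
    refine ⟨⟨⟨Finset.insert_subset hv hσ.1.1, ?_⟩, ?_⟩, Finset.mem_insert_self _ _⟩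
    · rw [Finset.card_insert_of_notMem hvσ, hσ.1.2]
    · rcases hσ.2 with rfl | h
      · exact (hW v).1 hv
      · exact h.2.2
  · intro σ hσ
    exact Finset.insert_erase ((Finset.mem_bipartiteAbove _).1 hσ).2
  · intro σ hσ
    refine Finset.erase_insert ?_
    rcases (Finset.mem_filter.1 hσ).2 with rfl | h
    · simp
    · exact h.2.1

end FaceNumbers

/-! ### Averaging over all vertex orderings -/

section Average

variable {V : Type*} [LinearOrder V]

/-- The number of intervals, in partitions of the skeletons of the vertex links, with
a minimum of `j` elements. -/
theorem sum_card_eq_gNumber (M : PreAbstractSimplicialComplex V) {d k c j : ℕ}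
    {W : Finset V} (hW : ∀ v, v ∈ W ↔ {v} ∈ M) {L : V → List (Finset V × Finset V)}
    (hL : ∀ v ∈ W, (M.link v).IsSkeletonShelling d k c (L v)) (hj : j ≤ c) (hjd : j ≤ d) :
    ∑ v ∈ W, ((L v).map fun q => if q.2.card = j then (1 : ℤ) else 0).sum =
      (j + 1) * M.gNumber d (j + 1) + (d + 2 - j) * M.gNumber d j := by
  classical
  rw [gNumber_succ_mul_add M hjd]
  have h : ∀ u ∈ Finset.range (j + 1), ((u + 1) * M.faceCount (u + 1) : ℤ) =
      ∑ v ∈ W, Nat.cast (R := ℤ) ((L v).map fun q => if q.2.card ≤ u then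
        (d + 1 - q.2.card).choose (u - q.2.card) else 0).sum := fun u hu => by
    have huc : u ≤ c := (Nat.lt_succ_iff.1 (Finset.mem_range.1 hu)).trans hj
    have h1 := succ_mul_faceCount_succ M hW u
    zify at h1
    rw [h1]
    refine Finset.sum_congr rfl fun v hv => ?_
    have h2 := hL v hv
    rw [← card_filter_exists_of_pairwise huc (L v) h2.disjoint h2.pairwise (A := W) ?_ h2.card_add]
    · congr 2
      refine Finset.filter_congr fun σ hσ => ?_
      exact h2.mem_iff σ ((Finset.mem_powersetCard.1 hσ).2.trans_le huc)
    · intro p hp x hx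
      exact (hW x).2 (M.mem_mono (h2.vertex p hp x hx).2.2 (Finset.subset_insert _ _) (by simp))
  symm
  rw [Finset.sum_congr rfl fun u hu => by rw [h u hu, Finset.mul_sum], Finset.sum_comm]
  exact Finset.sum_congr rfl fun v _ => alternating_sum_map_choose (L v) _ _ _

theorem sum_list_map_comm {ι α R : Type*} [AddCommMonoid R] (P : Finset ι) (L : List α)
    (f : ι → α → R) : ∑ p ∈ P, (L.map (f p)).sum = (L.map fun q => ∑ p ∈ P, f p q).sum := by
  induction L with
  | nil => simp
  | cons a L ih => simp [Finset.sum_add_distrib, ih]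

theorem list_sum_map_ite {α : Type*} (L : List α) (b : α → ℕ) (g : ℕ → ℚ) (l : ℕ) :
    (L.map fun q => if b q ≤ l then g (b q) else 0).sum =
      ∑ j ∈ Finset.range (l + 1), g j * (L.map fun q => if b q = j then (1 : ℤ) else 0).sum := by
  induction L with
  | nil => simp
  | cons a L ih =>
    simp [mul_add, Finset.sum_add_distrib, ih]

theorem sum_orderings (M : PreAbstractSimplicialComplex V) {d k c l : ℕ} {W : Finset V}
    (hW : ∀ v, v ∈ W ↔ {v} ∈ M) {v : V} (hv : v ∈ W) {L : List (Finset V × Finset V)}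
    (hL : (M.link v).IsSkeletonShelling d k c L) :
    ∑ p ∈ permsOfFinset W, (L.map fun q =>
        if q.2 ⊆ W.filter (p · < p v) ∧ Disjoint q.1 (W.filter (p · < p v)) ∧
          q.2.card ≤ l then (-1 : ℚ) ^ (l - q.2.card) else 0).sum =
      W.card.factorial * ∑ j ∈ Finset.range (l + 1),
        ((-1 : ℚ) ^ (l - j) / ((d + 2) * (d + 1).choose j)) *
          (L.map fun q => if q.2.card = j then (1 : ℤ) else 0).sum := by
  rw [sum_list_map_comm, ← list_sum_map_ite L (fun q => q.2.card)
    (fun j => (-1 : ℚ) ^ (l - j) / ((d + 2) * (d + 1).choose j)), ← List.sum_map_mul_left]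
  congr 1
  refine List.map_congr_left fun q hq => ?_
  by_cases hql : q.2.card ≤ l
  swap
  · simp [hql]
  have hqW : ∀ x ∈ q.1 ∪ q.2, x ∈ W ∧ x ≠ v := fun x hx => by
    have h := hL.vertex q hq x hx
    refine ⟨(hW x).2 (M.mem_mono h.2.2 (Finset.subset_insert _ _) (by simp)), fun hxv => ?_⟩
    exact h.2.1 (hxv ▸ Finset.mem_singleton_self _)
  have h1 : ∀ x ∈ q.1, x ∈ W ∧ x ≠ v := fun x hx => hqW x (Finset.mem_union_left _ hx)
  have h2 : ∀ x ∈ q.2, x ∈ W ∧ x ≠ v := fun x hx => hqW x (Finset.mem_union_right _ hx)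
  have hcard := card_orderings_mul_choose W q.1 q.2 (d := d) hv (fun x hx => (h1 x hx).1)
    (fun x hx => (h2 x hx).1) (fun h => (h1 v h).2 rfl) (fun h => (h2 v h).2 rfl)
    (hL.disjoint q hq) (hL.card_add q hq)
  have hset : ∀ p : Equiv.Perm V, (q.2 ⊆ W.filter (p · < p v) ∧
      Disjoint q.1 (W.filter (p · < p v)) ∧ q.2.card ≤ l) ↔
      ((∀ x ∈ q.2, p x < p v) ∧ ∀ x ∈ q.1, p v < p x) := fun p => by
    simp only [hql, and_true]
    refine and_congr ?_ ?_
    · refine ⟨fun h x hx => (Finset.mem_filter.1 (h hx)).2, fun h x hx => ?_⟩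
      exact Finset.mem_filter.2 ⟨(h2 x hx).1, h x hx⟩
    · rw [Finset.disjoint_left]
      refine ⟨fun h x hx => ?_, fun h x hx hx' => ?_⟩
      · refine lt_of_le_of_ne (not_lt.1 fun h' => h hx (Finset.mem_filter.2 ⟨(h1 x hx).1, h'⟩)) ?_
        exact fun h' => (h1 x hx).2 (p.injective h').symm
      · exact lt_asymm (h x hx) (Finset.mem_filter.1 hx').2
  simp only [hset]
  rw [if_pos hql]
  rw [Finset.sum_ite, Finset.sum_const_zero, add_zero, Finset.sum_const, nsmul_eq_mul, ← hcard]
  have : ((d + 1).choose q.2.card : ℚ) ≠ 0 := by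
    have := Nat.choose_pos (n := d + 1) (k := q.2.card) (by have := hL.card_add q hq; omega)
    positivity
  have : (d + 2 : ℚ) ≠ 0 := by positivity
  push_cast
  field_simp

theorem IsW.exists_isSkeletonShelling {M : PreAbstractSimplicialComplex V} {k d c : ℕ}
    (hM : M.IsW k d) (hc : 1 ≤ c) (hck : c + k ≤ d) :
    ∃ L : V → List (Finset V × Finset V), ∀ v, {v} ∈ M →
      (M.link v).IsSkeletonShelling d k c (L v) := by
  have h : ∀ v, ∃ L, {v} ∈ M → (M.link v).IsSkeletonShelling d k c L := fun v => by
    by_cases hv : {v} ∈ M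
    · obtain ⟨L, hL⟩ := (hM.link v hv).exists_isSkeletonShelling hc hck
      exact ⟨L, fun _ => hL⟩
    · exact ⟨[], fun h => absurd h hv⟩
  choose L hL using h
  exact ⟨L, hL⟩

/-- The left side is a multiple of the number of intervals with `|β| = j`, and all intervals have
`|β| ≤ k < j`. -/
theorem IsW.gNumber_div_add_eq_zero {M : PreAbstractSimplicialComplex V} {k d j : ℕ}
    (hM : M.IsW k d) (hkj : k < j) (hjd : j + k ≤ d) :
    (M.gNumber d (j + 1) / (d + 2).choose (j + 1) + M.gNumber d j / (d + 2).choose j : ℚ) = 0 := by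
  obtain ⟨L, hL⟩ := hM.exists_isSkeletonShelling (c := j) (by omega) hjd
  obtain ⟨W, hW⟩ := exists_vertexFinset hM.finite
  have h := sum_card_eq_gNumber M hW (j := j) (fun v hv => hL v ((hW v).1 hv)) le_rfl (by omega)
  rw [← gNumber_div_add_gNumber_div M (by omega), ← h, Finset.sum_eq_zero, Int.cast_zero, zero_div]
  intro v hv
  refine List.sum_eq_zero fun x hx => ?_
  obtain ⟨q, hq, rfl⟩ := List.mem_map.1 hx
  have := (hL v ((hW v).1 hv)).card_le q hq
  rw [if_neg (by omega)]

/-- If all triangular submatrices of the boundary matrix of `M` have size at most `r`, then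
`r` and the face numbers satisfy an inequality, by averaging over all orderings of the vertices. -/
theorem IsW.alternating_faceCount_sub_le {M : PreAbstractSimplicialComplex V} {k d l r : ℕ}
    (hM : M.IsW k d) (hl : l + k + 1 ≤ d)
    (hr : ∀ C, IsTriangular (l + 1) C → (∀ x ∈ C, x.2 ∈ M) → C.length ≤ r) :
    ((∑ u ∈ Finset.range (l + 1), (-1) ^ (l - u) * (M.faceCount (u + 1) : ℤ) - r : ℤ) : ℚ) ≤
      M.gNumber d (l + 1) / (d + 2).choose (l + 1) + (-1) ^ l := by
  classical
  obtain ⟨L, hL⟩ := hM.exists_isSkeletonShelling (c := l + 1) (by omega) (by omega)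
  obtain ⟨W, hW⟩ := exists_vertexFinset hM.finite
  have hL' : ∀ v ∈ W, (M.link v).IsSkeletonShelling d k (l + 1) (L v) :=
    fun v hv => hL v ((hW v).1 hv)
  -- For each ordering, the alternating face count is the size of the triangular block, at most `r`,
  -- plus the unmatched terms.
  have hp : ∀ p ∈ permsOfFinset W,
      ((∑ u ∈ Finset.range (l + 1), (-1) ^ (l - u) * (M.faceCount (u + 1) : ℤ) - r : ℤ) : ℚ) ≤
      ∑ v ∈ W, ((L v).map fun q =>
        if q.2 ⊆ W.filter (p · < p v) ∧ Disjoint q.1 (W.filter (p · < p v)) ∧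
          q.2.card ≤ l then (-1 : ℚ) ^ (l - q.2.card) else 0).sum := by
    intro p _
    obtain ⟨C, hC, hCM, hsum⟩ := exists_isTriangular_of_links M (l := l) le_rfl
      (fun v hv => (hW v).1 hv) hL' p.injective
    have h := hr C hC fun x hx => (hCM x hx).2
    simp only [faceCount_succ_eq_card M hW]
    have h' : (∑ u ∈ Finset.range (l + 1), (-1 : ℤ) ^ (l - u) *
          ((W.powersetCard (u + 1)).filter (· ∈ M)).card) - r ≤ ∑ v ∈ W, ((L v).map fun q =>
          if q.2 ⊆ W.filter (p · < p v) ∧ Disjoint q.1 (W.filter (p · < p v)) ∧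
            q.2.card ≤ l then (-1 : ℤ) ^ (l - q.2.card) else 0).sum := by
      rw [hsum]
      have : (C.length : ℤ) ≤ r := by exact_mod_cast h
      linarith
    refine (Int.cast_le.2 h').trans_eq ?_
    rw [Int.cast_sum]
    refine Finset.sum_congr rfl fun v _ => ?_
    rw [Int.cast_list_sum, List.map_map]
    congr 1
    refine List.map_congr_left fun q _ => ?_
    simp only [Function.comp]
    split_ifs <;> push_cast <;> rfl
  have hsum := Finset.sum_le_sum hp
  rw [Finset.sum_const, card_perms_of_finset, nsmul_eq_mul, Finset.sum_comm,
    Finset.sum_congr rfl fun v hv => sum_orderings M hW hv (hL' v hv), ← Finset.mul_sum] at hsum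
  have hpos : (0 : ℚ) < W.card.factorial := by exact_mod_cast Nat.factorial_pos _
  refine (le_of_mul_le_mul_left hsum hpos).trans_eq ?_
  rw [Finset.sum_comm]
  have hj : ∀ j ∈ Finset.range (l + 1), ∑ v ∈ W,
      ((-1 : ℚ) ^ (l - j) / ((d + 2) * (d + 1).choose j)) *
        ((L v).map fun q => if q.2.card = j then (1 : ℤ) else 0).sum =
      (-1) ^ (l - j) * (M.gNumber d (j + 1) / (d + 2).choose (j + 1) +
        M.gNumber d j / (d + 2).choose j) := fun j hj => by
    rw [Finset.mem_range] at hj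
    rw [← Finset.mul_sum, ← Int.cast_sum, sum_card_eq_gNumber M hW hL' (by omega) (by omega),
      ← gNumber_div_add_gNumber_div M (by omega)]
    ring
  rw [Finset.sum_congr rfl hj]
  clear hj hsum hp hL' hL hr hl
  -- The sum telescopes; the surviving lower end is `(-1)^l * g_0` with `g_0 = 1`.
  induction l with
  | zero => simp [gNumber, hNumber, faceCount]
  | succ l ih =>
    rw [Finset.sum_range_succ, Finset.sum_congr rfl fun j hj => by
      rw [show l + 1 - j = l - j + 1 by rw [Finset.mem_range] at hj; omega, pow_succ, mul_right_comm],
      ← Finset.sum_mul, ih, Nat.sub_self, pow_succ]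
    ring

end Average

end PreAbstractSimplicialComplex

namespace PreAbstractSimplicialComplex

/-! ### The simplicial boundary operator and independence of boundaries -/

section Boundary

variable {V : Type*} [LinearOrder V] (F : Type*) [Field F]

theorem boundaryMap_single (σ : Finset V) (a : F) :
    boundaryMap V F (Finsupp.single σ a) =
      a • ∑ v ∈ σ, Finsupp.single (σ.erase v) ((-1 : F) ^ (σ.filter (· < v)).card) := by
  rw [boundaryMap, Finsupp.linearCombination_single]

theorem boundary_sign_antisymm (σ : Finset V) {v w : V} (hv : v ∈ σ) (hvw : v < w) :
    (-1 : F) ^ (σ.filter (· < v)).card * (-1) ^ ((σ.erase v).filter (· < w)).card +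
      (-1) ^ (σ.filter (· < w)).card * (-1) ^ ((σ.erase w).filter (· < v)).card = 0 := by
  have h1 : (σ.erase w).filter (· < v) = σ.filter (· < v) := by
    ext x
    simp only [Finset.mem_filter, Finset.mem_erase]
    constructor
    · rintro ⟨⟨-, h⟩, h'⟩; exact ⟨h, h'⟩
    · rintro ⟨h, h'⟩; exact ⟨⟨(h'.trans hvw).ne, h⟩, h'⟩
  have h2 : ((σ.erase v).filter (· < w)).card + 1 = (σ.filter (· < w)).card := by
    rw [Finset.filter_erase]
    exact Finset.card_erase_add_one (Finset.mem_filter.2 ⟨hv, hvw⟩)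
  rw [h1, ← h2, pow_succ]
  ring

theorem boundaryMap_comp_boundaryMap : boundaryMap V F ∘ₗ boundaryMap V F = 0 := by
  refine Finsupp.lhom_ext fun σ a => ?_
  rw [LinearMap.comp_apply, boundaryMap_single, map_smul, map_sum, LinearMap.zero_apply]
  have h : ∀ v ∈ σ, boundaryMap V F (Finsupp.single (σ.erase v)
      ((-1 : F) ^ (σ.filter (· < v)).card)) =
      ∑ w ∈ σ.erase v, Finsupp.single ((σ.erase v).erase w)
        ((-1 : F) ^ (σ.filter (· < v)).card * (-1) ^ ((σ.erase v).filter (· < w)).card) :=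
    fun v _ => by
      rw [boundaryMap_single, Finset.smul_sum]
      simp
  -- Removing `v` then `w` cancels against removing `w` then `v`.
  rw [Finset.sum_congr rfl h, Finset.sum_sigma', Finset.sum_involution
    (fun x _ => (⟨x.2, x.1⟩ : (_ : V) × V)), smul_zero]
  · rintro ⟨v, w⟩ hx
    simp only [Finset.mem_sigma, Finset.mem_erase] at hx
    rw [Finset.erase_right_comm, ← Finsupp.single_add]
    dsimp only
    rcases lt_or_gt_of_ne hx.2.1 with h | h
    · rw [add_comm, boundary_sign_antisymm F σ hx.2.2 h, Finsupp.single_zero]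
    · rw [boundary_sign_antisymm F σ hx.1 h, Finsupp.single_zero]
  · rintro ⟨v, w⟩ hx - he
    simp only [Finset.mem_sigma, Finset.mem_erase] at hx
    simp only [Sigma.mk.injEq] at he
    exact hx.2.1 he.1
  · rintro ⟨v, w⟩ hx
    simp only [Finset.mem_sigma, Finset.mem_erase] at hx ⊢
    exact ⟨hx.2.2, Ne.symm hx.2.1, hx.1⟩
  · rintro ⟨v, w⟩ _
    rfl

theorem boundaryMap_single_apply_eq_zero {σ τ : Finset V} (h : ¬ σ ⊆ τ) :
    boundaryMap V F (Finsupp.single τ 1) σ = 0 := by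
  rw [boundaryMap_single, one_smul, Finsupp.finsetSum_apply]
  refine Finset.sum_eq_zero fun v _ => Finsupp.single_eq_of_ne ?_
  rintro rfl
  exact h (Finset.erase_subset _ _)

theorem boundaryMap_single_apply_ne_zero {σ τ : Finset V} (h : σ ⊆ τ)
    (hcard : τ.card = σ.card + 1) : boundaryMap V F (Finsupp.single τ 1) σ ≠ 0 := by
  obtain ⟨v, hv, rfl⟩ : ∃ v ∈ τ, τ.erase v = σ := by
    have h1 : (τ \ σ).card = 1 := by rw [Finset.card_sdiff_of_subset h]; omega
    obtain ⟨v, hv⟩ := Finset.card_eq_one.1 h1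
    refine ⟨v, (Finset.mem_sdiff.1 (hv ▸ Finset.mem_singleton_self v)).1, ?_⟩
    rw [Finset.erase_eq, ← hv, Finset.sdiff_sdiff_eq_self h]
  rw [boundaryMap_single, one_smul, Finsupp.finsetSum_apply, Finset.sum_eq_single_of_mem v hv]
  · rw [Finsupp.single_eq_same]
    exact pow_ne_zero _ (by simp)
  · intro w hw hwv
    refine Finsupp.single_eq_of_ne fun he => ?_
    have : w ∈ τ.erase v := Finset.mem_erase.2 ⟨hwv, hw⟩
    rw [he] at this
    simp at this

/-- The coefficient at `x.1` is a sign for the boundary of `x.2` and zero for the boundaries of all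
later columns. Signs are nonzero in every field, so the bound is independent of `F`. -/
theorem IsTriangular.linearIndependent {s : ℕ} {C : List (Finset V × Finset V)}
    (hC : IsTriangular s C) : LinearIndependent F
      fun i : Fin C.length => boundaryMap V F (Finsupp.single (C.get i).2 1) := by
  induction C with
  | nil =>
    have : IsEmpty (Fin ([] : List (Finset V × Finset V)).length) := inferInstanceAs (IsEmpty (Fin 0))
    exact linearIndependent_empty_type
  | cons x C ih =>
    have hC' := List.pairwise_cons.1 hC.2
    have ih := ih ⟨fun y hy => hC.1 y (List.mem_cons_of_mem _ hy), hC'.2⟩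
    have hx := hC.1 x List.mem_cons_self
    have heq : (fun i : Fin (x :: C).length =>
        boundaryMap V F (Finsupp.single ((x :: C).get i).2 1)) =
        Fin.cons (boundaryMap V F (Finsupp.single x.2 1))
          fun i : Fin C.length => boundaryMap V F (Finsupp.single (C.get i).2 1) :=
      funext fun i => Fin.cases rfl (fun _ => rfl) i
    rw [heq]
    refine linearIndependent_finCons.2 ⟨ih, fun hmem => ?_⟩
    have hle : Submodule.span F (Set.range fun i : Fin C.length =>
        boundaryMap V F (Finsupp.single (C.get i).2 1)) ≤
        LinearMap.ker (Finsupp.lapply (R := F) x.1 : (Finset V →₀ F) →ₗ[F] F) := by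
      rw [Submodule.span_le]
      rintro _ ⟨i, rfl⟩
      exact boundaryMap_single_apply_eq_zero F (hC'.1 _ (List.get_mem C i))
    exact boundaryMap_single_apply_ne_zero F hx.1 (by rw [hx.2.1, hx.2.2]) (hle hmem)

end Boundary

/-! ### Betti numbers, the lower bound, and equality in the middle range -/

section Betti

variable (F : Type*) [Field F]

theorem finrank_supported {α : Type*} {s : Set α} (hs : s.Finite) :
    FiniteDimensional F (Finsupp.supported F F s) ∧
      Module.finrank F (Finsupp.supported F F s) = s.ncard := by
  have := hs.fintype
  have e := Finsupp.supportedEquivFinsupp (M := F) (R := F) s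
  refine ⟨Module.Finite.equiv e.symm, ?_⟩
  rw [e.finrank_eq, Module.finrank_finsupp_self, Set.ncard_eq_toFinset_card', Set.toFinset_card]

variable {V : Type*} {M : PreAbstractSimplicialComplex V}

theorem finiteDimensional_chains (hM : M.faces.Finite) (i : ℕ) :
    FiniteDimensional F (M.chains F i) :=
  (finrank_supported F (hM.subset fun _ h => h.1)).1

theorem finrank_chains (hM : M.faces.Finite) (i : ℕ) :
    Module.finrank F (M.chains F i) = M.faceCount (i + 1) := by
  rw [faceCount, if_neg (Nat.succ_ne_zero i)]
  exact (finrank_supported F (hM.subset fun _ h => h.1)).2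

variable [LinearOrder V]

theorem IsTriangular.length_le_finrank (hM : M.faces.Finite) {s : ℕ}
    {C : List (Finset V × Finset V)} (hC : IsTriangular s C) (hCM : ∀ x ∈ C, x.2 ∈ M) :
    C.length ≤ Module.finrank F ((M.chains F s).map (boundaryMap V F)) := by
  have := finiteDimensional_chains F hM s
  have h := finrank_span_eq_card (hC.linearIndependent F)
  rw [Fintype.card_fin] at h
  rw [← h]
  refine Submodule.finrank_mono (Submodule.span_le.2 ?_)
  rintro _ ⟨i, rfl⟩
  have hi := List.get_mem C i
  exact Submodule.mem_map_of_mem (Finsupp.single_mem_supported F _ ⟨hCM _ hi, (hC.1 _ hi).2.2⟩)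

theorem finrank_map_add_finrank_inf_ker {C D : Type*} [AddCommGroup C] [Module F C]
    [AddCommGroup D] [Module F D] (f : C →ₗ[F] D) (S : Submodule F C) [FiniteDimensional F S] :
    Module.finrank F (S.map f) + Module.finrank F (S ⊓ LinearMap.ker f : Submodule F C) =
      Module.finrank F S := by
  have h := LinearMap.finrank_range_add_finrank_ker (f.domRestrict S)
  rw [LinearMap.range_domRestrict] at h
  rw [← h, LinearMap.ker_domRestrict, inf_comm, ← Submodule.finrank_map_subtype_eq,
    Submodule.map_comap_subtype, inf_comm]

theorem quotientDim_add_finrank {C : Type*} [AddCommGroup C] [Module F C] {Z B : Submodule F C}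
    (hle : B ≤ Z) [FiniteDimensional F Z] :
    quotientDim Z B + Module.finrank F B = Module.finrank F Z := by
  rw [quotientDim, ← (Submodule.submoduleOfEquivOfLe hle).finrank_eq]
  exact Submodule.finrank_quotient_add_finrank _

theorem boundaries_le_chains (i : ℕ) : M.boundaries F i ≤ M.chains F i := by
  rw [boundaries, chains, Finsupp.supported_eq_span_single, Submodule.map_span, Submodule.span_le]
  rintro _ ⟨_, ⟨σ, ⟨hσ, hσc⟩, rfl⟩, rfl⟩
  rw [SetLike.mem_coe, boundaryMap_single, one_smul]
  refine Submodule.sum_mem _ fun v hv => Finsupp.single_mem_supported F _ ⟨?_, ?_⟩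
  · refine M.mem_mono hσ (Finset.erase_subset _ _) (Finset.card_pos.1 ?_)
    rw [Finset.card_erase_of_mem hv]
    omega
  · rw [Finset.card_erase_of_mem hv]
    omega

theorem boundaries_le_ker (i : ℕ) : M.boundaries F i ≤ LinearMap.ker (boundaryMap V F) := by
  rintro _ ⟨x, -, rfl⟩
  exact LinearMap.congr_fun (boundaryMap_comp_boundaryMap F) x

/-- Rank–nullity for the boundary map on `(i + 1)`-chains. -/
theorem betti_succ_add (hM : M.faces.Finite) (i : ℕ) :
    M.betti F (i + 1) + Module.finrank F (M.boundaries F i) +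
      Module.finrank F (M.boundaries F (i + 1)) = M.faceCount (i + 2) := by
  have := finiteDimensional_chains F hM (i + 1)
  have hle : M.boundaries F (i + 1) ≤ M.cycles F (i + 1) :=
    le_inf (boundaries_le_chains F _) (boundaries_le_ker F _)
  have : FiniteDimensional F (M.cycles F (i + 1)) :=
    Submodule.finiteDimensional_of_le (inf_le_left : _ ≤ M.chains F (i + 1))
  have h1 := finrank_map_add_finrank_inf_ker F (boundaryMap V F) (M.chains F (i + 1))
  have h2 := quotientDim_add_finrank F hle
  rw [finrank_chains F hM] at h1
  change M.betti F (i + 1) + _ = Module.finrank F (M.cycles F (i + 1)) at h2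
  change Module.finrank F (M.boundaries F i) + Module.finrank F (M.cycles F (i + 1)) =
    M.faceCount (i + 2) at h1
  omega

/-- This is `β_0 = 1` in terms of ranks; 2-neighbourliness enters the argument only here, to supply
all edges at `v₀`. -/
theorem finrank_boundaries_zero (hM : M.faces.Finite) {v₀ : V} (hv₀ : {v₀} ∈ M)
    (hN : M.Neighbourly 2) :
    Module.finrank F (M.boundaries F 0) + 1 = M.faceCount 1 := by
  classical
  have := finiteDimensional_chains F hM 0
  apply le_antisymm
  -- `boundaryMap` sends vertices to the empty set, so on `0`-chains it is the augmentation. It has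
  -- positive rank and kills the boundaries of edges.
  · have h1 : IsTriangular 0 [(∅, {v₀})] := by simp [IsTriangular]
    have h2 := h1.length_le_finrank F hM (by simpa using hv₀)
    have h3 := finrank_map_add_finrank_inf_ker F (boundaryMap V F) (M.chains F 0)
    rw [finrank_chains F hM, zero_add] at h3
    have : FiniteDimensional F
        (M.chains F 0 ⊓ LinearMap.ker (boundaryMap V F) : Submodule F _) :=
      Submodule.finiteDimensional_of_le (inf_le_left : _ ≤ M.chains F 0)
    have h4 := Submodule.finrank_mono
      (le_inf (boundaries_le_chains F (M := M) 0) (boundaries_le_ker F 0))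
    simp only [List.length_singleton] at h2
    omega
  · obtain ⟨W, hW⟩ := exists_vertexFinset hM
    have hW1 : M.faceCount 1 = W.card := by
      rw [faceCount_succ_eq_card M hW, Finset.filter_true_of_mem, Finset.card_powersetCard,
        Nat.choose_one_right]
      intro σ hσ
      rw [zero_add, Finset.mem_powersetCard, Finset.card_eq_one] at hσ
      obtain ⟨h, x, rfl⟩ := hσ
      exact (hW x).1 (h (Finset.mem_singleton_self x))
    have hpair : ∀ v ∈ W.erase v₀, v ≠ v₀ ∧ ({v₀, v} : Finset V).card = 2 := fun v hv =>
      ⟨Finset.ne_of_mem_erase hv, Finset.card_pair (Finset.ne_of_mem_erase hv).symm⟩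
    -- The star of edges at `v₀` is a spanning tree, giving `f_0 - 1` independent boundaries.
    let C := (W.erase v₀).toList.map fun v => (({v} : Finset V), ({v₀, v} : Finset V))
    have hC : IsTriangular 1 C := by
      refine ⟨fun x hx => ?_, ?_⟩
      · obtain ⟨v, hv, rfl⟩ := List.mem_map.1 hx
        rw [Finset.mem_toList] at hv
        exact ⟨by simp, by simp, (hpair v hv).2⟩
      · rw [List.pairwise_map]
        refine (Finset.nodup_toList _).imp_of_mem fun {v w} hv _ hne hs => ?_
        rw [Finset.mem_toList] at hv
        have := hs (Finset.mem_singleton_self v)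
        rw [Finset.mem_insert, Finset.mem_singleton] at this
        exact this.elim (hpair v hv).1 hne
    have h := hC.length_le_finrank F hM fun x hx => by
      obtain ⟨v, hv, rfl⟩ := List.mem_map.1 hx
      rw [Finset.mem_toList] at hv
      refine hN _ (by simp) (fun x hx => ?_) (hpair v hv).2
      rw [Finset.mem_insert, Finset.mem_singleton] at hx
      rcases hx with rfl | rfl
      · exact hv₀
      · exact (hW _).1 (Finset.mem_of_mem_erase hv)
    rw [List.length_map, Finset.length_toList] at h
    rw [hW1, ← Finset.card_erase_add_one ((hW v₀).2 hv₀)]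
    exact Nat.add_le_add_right h 1

theorem sum_Icc_succ (f : ℕ → ℤ) (l : ℕ) :
    ∑ i ∈ Finset.Icc 1 (l + 1), (-1) ^ (l + 1 - i) * f i =
      f (l + 1) - ∑ i ∈ Finset.Icc 1 l, (-1) ^ (l - i) * f i := by
  rw [Finset.sum_Icc_succ_top (by omega), Nat.sub_self, pow_zero, one_mul, add_comm,
    sub_eq_add_neg, ← Finset.sum_neg_distrib]
  congr 1
  refine Finset.sum_congr rfl fun u hu => ?_
  rw [Nat.sub_add_comm (Finset.mem_Icc.1 hu).2, pow_succ]
  ring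

/-- A truncated Euler–Poincaré formula: the ranks cancel in pairs except the last one, and `(-1)^l`
accounts for the omitted `β_0 = 1`. -/
theorem alternating_betti_eq (hM : M.faces.Finite) {v₀ : V} (hv₀ : {v₀} ∈ M)
    (hN : M.Neighbourly 2) (l : ℕ) :
    ∑ i ∈ Finset.Icc 1 l, (-1) ^ (l - i) * (M.betti F i : ℤ) =
      ∑ u ∈ Finset.range (l + 1), (-1) ^ (l - u) * (M.faceCount (u + 1) : ℤ) -
        Module.finrank F (M.boundaries F l) - (-1) ^ l := by
  induction l with
  | zero =>
    have := finrank_boundaries_zero F hM hv₀ hN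
    simp [← this]
  | succ l ih =>
    have h := betti_succ_add F hM l
    zify at h
    rw [sum_Icc_succ, ih, alternating_sum_succ (fun u => (M.faceCount (u + 1) : ℤ)), pow_succ]
    linear_combination h

theorem IsW.alternating_betti_le {k d l : ℕ} (hM : M.IsW k d) (hN : M.Neighbourly 2)
    (hl : l + k + 1 ≤ d) :
    ((∑ i ∈ Finset.Icc 1 l, (-1) ^ (l - i) * (M.betti F i : ℤ) : ℤ) : ℚ) ≤
      M.gNumber d (l + 1) / (d + 2).choose (l + 1) := by
  obtain ⟨v₀, hv₀⟩ := hM.connected.1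
  have h := hM.alternating_faceCount_sub_le hl (r := Module.finrank F (M.boundaries F l))
    fun C hC hCM => hC.length_le_finrank F hM.finite hCM
  rw [alternating_betti_eq F hM.finite hv₀ hN]
  push_cast at h ⊢
  linarith

/-- The Betti numbers of `M` vanish, and the lower bounds are attained, in the middle range. -/
theorem IsW.betti_eq_zero_and {k d l : ℕ} (hM : M.IsW k d) (hN : M.Neighbourly 2)
    (hkl : k ≤ l) (hl : l + k + 2 ≤ d) :
    M.betti F (l + 1) = 0 ∧
      ((∑ i ∈ Finset.Icc 1 l, (-1) ^ (l - i) * (M.betti F i : ℤ) : ℤ) : ℚ) =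
        M.gNumber d (l + 1) / (d + 2).choose (l + 1) ∧
      ((∑ i ∈ Finset.Icc 1 (l + 1), (-1) ^ (l + 1 - i) * (M.betti F i : ℤ) : ℤ) : ℚ) =
        M.gNumber d (l + 2) / (d + 2).choose (l + 2) := by
  have h1 := hM.alternating_betti_le F hN (l := l) (by omega)
  have h2 := hM.alternating_betti_le F hN (l := l + 1) (by omega)
  have h3 := hM.gNumber_div_add_eq_zero (j := l + 1) (by omega) (by omega)
  have h4 : (0 : ℚ) ≤ M.betti F (l + 1) := Nat.cast_nonneg _
  have h5 := congrArg (Int.cast (R := ℚ)) (sum_Icc_succ (fun i => (M.betti F i : ℤ)) l)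
  rw [Int.cast_sub, Int.cast_natCast] at h5
  refine ⟨?_, ?_, ?_⟩
  -- The left sides of `h1` and `h2` add up to `β_{l+1}` and the right sides to `0` by `h3`.
  · have : (M.betti F (l + 1) : ℚ) = 0 := by linarith
    exact_mod_cast this
  · linarith
  · linarith

end Betti

end PreAbstractSimplicialComplex

theorem proposition4p21 {V : Type*} [LinearOrder V] (F : Type*) [Field F] (k d : ℕ)
    (M : PreAbstractSimplicialComplex V) (hM : M.IsW k d) (hN : M.Neighbourly 2) :
    (d = 2 * k → ∀ l : ℕ, 1 ≤ l → l + 1 ≤ k →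
      M.gNumber d (l + 1) ≥
        ((d + 2).choose (l + 1) : ℤ) * ∑ i ∈ Finset.Icc 1 l, (-1) ^ (l - i) * (M.betti F i : ℤ)) ∧
    (2 * k + 1 ≤ d → ∀ l : ℕ, 1 ≤ l → l ≤ k →
      M.gNumber d (l + 1) ≥
        ((d + 2).choose (l + 1) : ℤ) * ∑ i ∈ Finset.Icc 1 l, (-1) ^ (l - i) * (M.betti F i : ℤ)) ∧
    (2 * k + 2 ≤ d → ∀ l : ℕ, k ≤ l → l + k + 1 ≤ d →
      M.gNumber d (l + 1) =
        ((d + 2).choose (l + 1) : ℤ) * ∑ i ∈ Finset.Icc 1 l, (-1) ^ (l - i) * (M.betti F i : ℤ)) ∧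
    (2 * k + 2 ≤ d → ∀ i : ℕ, k + 1 ≤ i → i + k + 1 ≤ d → M.betti F i = 0) := by
  have hpos : ∀ l : ℕ, l + k + 1 ≤ d → (0 : ℚ) < (d + 2).choose (l + 1) := fun l hl => by
    exact_mod_cast Nat.choose_pos (by omega)
  have hle : ∀ l : ℕ, l + k + 1 ≤ d → M.gNumber d (l + 1) ≥
      ((d + 2).choose (l + 1) : ℤ) *
        ∑ i ∈ Finset.Icc 1 l, (-1) ^ (l - i) * (M.betti F i : ℤ) := fun l hl => by
    have h := hM.alternating_betti_le F hN hl
    rw [le_div_iff₀' (hpos l hl)] at h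
    exact_mod_cast h
  have heq : ∀ l : ℕ, l + k + 1 ≤ d →
      ((∑ i ∈ Finset.Icc 1 l, (-1) ^ (l - i) * (M.betti F i : ℤ) : ℤ) : ℚ) =
        M.gNumber d (l + 1) / (d + 2).choose (l + 1) → M.gNumber d (l + 1) =
      ((d + 2).choose (l + 1) : ℤ) *
        ∑ i ∈ Finset.Icc 1 l, (-1) ^ (l - i) * (M.betti F i : ℤ) := fun l hl h => by
    rw [eq_div_iff (hpos l hl).ne', mul_comm] at h
    exact_mod_cast h.symm
  refine ⟨fun hd l _ hl => hle l (by omega), fun hd l _ hl => hle l (by omega),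
    fun hd l hkl hl => heq l hl ?_, fun hd i hi hid => ?_⟩
  -- The first equality of `IsW.betti_eq_zero_and` stops short of `l = d - k - 1`, and the second,
  -- applied at `l - 1`, does not reach `l = k`; together they cover the range.
  · rcases hkl.eq_or_lt with rfl | h
    · exact (hM.betti_eq_zero_and F hN le_rfl (by omega)).2.1
    · obtain ⟨m, rfl⟩ : ∃ m, l = m + 1 := ⟨l - 1, by omega⟩
      exact (hM.betti_eq_zero_and F hN (l := m) (by omega) (by omega)).2.2
  · obtain ⟨m, rfl⟩ : ∃ m, i = m + 1 := ⟨i - 1, by omega⟩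
    exact (hM.betti_eq_zero_and F hN (l := m) (by omega) (by omega)).1
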